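/- Let $\alpha\ge 2$ be an integer and let $1\ge\gamma_1\ge\gamma_2\ge\dots>0$. Let $\varphi_s(x)=\prod_{j=1}^s(2\pi)^{-1/2}e^{-x_j^2/2}$ be the standard normal density on $\mathbb R^s$, and let $H_s$ be the weighted anchored Gaussian Sobolev space of functions $f:\mathbb R^s\to\mathbb R$ (with mixed partial derivatives up to order $\alpha$ in each variable, those of order less than $\alpha$ in a variable being locally absolutely continuous in that variable) with finite norm $$\|f\|_s^2=\sum_{u\subseteq\{1,\dots,s\}}\ \sum_{\tau\in\{0,\dots,\alpha-1\}^{u}}\Big(\prod_{j\notin u}\gamma_j^{-1}\prod_{j\in u,\ \tau_j\ne0}\gamma_j^{-1}\Big)\int_{\mathbb R^{s-|u|}}\Big(\partial^{(\tau_u,\alpha_{-u})}f(x_{-u},0_u)\Big)^2\varphi_{s-|u|}(x_{-u})\,dx_{-u},$$ where $\partial^{(\tau_u,\alpha_{-u})}$ differentiates $\tau_j$ times in $x_j$ for $j\in u$ and $\alpha$ times for $j\notin u$. For $n\ge0$ let $$e(n,s)=\inf_{w_i\in\mathbb R,\ p_i\in\mathbb R^s}\ \sup_{\|f\|_s\le1}\Big|\int_{\mathbb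 R^s} f(x)\varphi_s(x)\,dx-\sum_{i=1}^n w_i f(p_i)\Big|.$$ For $s\ge1$ and $\varepsilon\in(0,1)$ let $n(\varepsilon,s)$ be the least $n\ge 0$ with $e(n,s)\le\varepsilon$ (absolute error criterion) or with $e(n,s)\le\varepsilon\, e(0,s)$ (normalized error criterion). One says that the integration problem satisfies, under the chosen criterion, * SPT (strong polynomial tractability) if there are $\tau,C\ge0$ with $n(\varepsilon,s)\le C\varepsilon^{-\tau}$ for all $s\ge1$, $\varepsilon\in(0,1)$; * PT (polynomial tractability) if there are $\tau,\sigma,C\ge0$ with $n(\varepsilon,s)\le C\varepsilon^{-\tau}s^{\sigma}$ for all $s\ge1$, $\varepsilon\in(0,1)$; * $(\sigma,\tau)$-WT (weak tractability with parameters $\sigma,\tau>0$) if $\ln n(\varepsilon,s)/(s^{\sigma}+\varepsilon^{-\tau})\to0$ as $s+\varepsilon^{-1}\to\infty$; WT (weak tractability) is $(1,1)$-WT; * UWT (uniform weak tractability) if $(\sigma,\tau)$-WT holds for all $\sigma,\tau\in(0,1]$. Then, for each of the two error criteria: 1. SPT holds if and only if $\sum_{j=1}^\infty\gamma_j<\infty$.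 2. PT holds if and only if $\limsup_{s\to\infty}\frac1{\ln s}\sum_{j=1}^s\gamma_j<\infty$. 3. WT holds if and only if $\lim_{s\to\infty}\frac1s\sum_{j=1}^s\gamma_j=0$. 4. For all $\sigma\in(0,1]$ and $\tau>0$, $(\sigma,\tau)$-WT holds if and only if $\lim_{s\to\infty}\frac1{s^\sigma}\sum_{j=1}^s\gamma_j=0$. 5. UWT holds if and only if $\lim_{s\to\infty}\frac1{s^\sigma}\sum_{j=1}^s\gamma_j=0$ for all $\sigma\in(0,1]$. -/

import Mathlib

open Filter Topology MeasureTheory ProbabilityTheory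
open scoped ENNReal

noncomputable section

namespace AnchoredSpace

/-- The standard Gaussian measure on `ℝ ^ s`, with density `∏ j, exp (-x j ^ 2 / 2) / √(2 π)`. -/
def gaussian (s : ℕ) : Measure (Fin s → ℝ) :=
  Measure.pi fun _ => gaussianReal 0 1

/-- `D` is a system of mixed partial derivatives `∂ ^ τ f`, `0 ≤ τ ≤ α` (coordinatewise), of `f`:
`D τ` is locally absolutely continuous in every coordinate `x j` with `τ j < α`, with derivative
`D (τ + e j)` in that coordinate.  For `s = 1` this says that `f` is `α - 1` times
differentiable, that `f ^ (α - 1)` is locally absolutely continuous, and that `D τ = f ^ (τ)`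
(almost everywhere if `τ = α`).  In general `D τ` is the classical partial derivative if `τ < α`
in every coordinate; otherwise `D τ` is the partial derivative in the weak sense, in a version
which has traces on the coordinate planes `x j = c` for the `j` with `τ j < α`. -/
structure IsDerivSystem (α : ℕ) {s : ℕ} (f : (Fin s → ℝ) → ℝ)
    (D : (Fin s → ℕ) → (Fin s → ℝ) → ℝ) : Prop where
  zero : D 0 = f
  measurable : ∀ τ : Fin s → ℕ, (∀ i, τ i ≤ α) → Measurable (D τ)
  intervalIntegrable : ∀ τ : Fin s → ℕ, (∀ i, τ i ≤ α) → ∀ j, τ j < α →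
    ∀ (x : Fin s → ℝ) (a b : ℝ),
      IntervalIntegrable (fun t => D (τ + Pi.single j 1) (Function.update x j t)) volume a b
  sub_eq_integral : ∀ τ : Fin s → ℕ, (∀ i, τ i ≤ α) → ∀ j, τ j < α →
    ∀ (x : Fin s → ℝ) (a b : ℝ),
      D τ (Function.update x j b) - D τ (Function.update x j a) =
        ∫ t in a..b, D (τ + Pi.single j 1) (Function.update x j t)

/-- The squared anchored norm
`∑_{u ⊆ [s]} ∑_{τ_u ∈ {0, …, α - 1} ^ u} γ_{τ_u}⁻¹
  ∫_{ℝ ^ (s - |u|)} (∂ ^ (τ_u, α_{-u}) f (x_{-u}, 0)) ^ 2 φ (x_{-u}) dx_{-u}`.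
A pair `(u, τ_u)` is coded by the multiindex `κ = (τ_u, α_{-u}) ∈ {0, …, α} ^ s`, so that
`u = {j | κ j < α}`, and `γ_{τ_u}` is the product of the `γ j` with `κ j ≠ 0`.  The integrand does
not depend on `x_u`, so integrating over all of `ℝ ^ s` against the Gaussian probability measure
is the same as integrating over `ℝ ^ (s - |u|)`. -/
def normSq (α : ℕ) (γ : ℕ → ℝ) {s : ℕ} (D : (Fin s → ℕ) → (Fin s → ℝ) → ℝ) : ℝ≥0∞ :=
  ∑ κ ∈ Fintype.piFinset fun _ : Fin s => Finset.range (α + 1),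
    ENNReal.ofReal (∏ j : Fin s, if κ j = 0 then 1 else γ j)⁻¹ *
      ∫⁻ x, ENNReal.ofReal (D κ (fun j => if κ j < α then 0 else x j) ^ 2) ∂gaussian s

/-- The closed unit ball of the weighted anchored Gaussian Sobolev space on `ℝ ^ s` with smoothness
`α` and product weights `γ 0, …, γ (s - 1)` (coordinates are numbered from `0`). -/
def unitBall (α : ℕ) (γ : ℕ → ℝ) (s : ℕ) : Set ((Fin s → ℝ) → ℝ) :=
  {f | ∃ D, IsDerivSystem α f D ∧ normSq α γ D ≤ 1}

/-- The worst case error over the unit ball of the linear algorithm `f ↦ ∑ i, w i * f (p i)` for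
Gaussian integration. -/
def worstCaseError (α : ℕ) (γ : ℕ → ℝ) (s : ℕ) {n : ℕ} (w : Fin n → ℝ)
    (p : Fin n → Fin s → ℝ) : ℝ≥0∞ :=
  ⨆ f ∈ unitBall α γ s, ENNReal.ofReal |∫ x, f x ∂gaussian s - ∑ i, w i * f (p i)|

/-- The `n`-th minimal worst case error.  For `n = 0` this is the initial error. -/
def minError (α : ℕ) (γ : ℕ → ℝ) (s n : ℕ) : ℝ≥0∞ :=
  ⨅ (w : Fin n → ℝ) (p : Fin n → Fin s → ℝ), worstCaseError α γ s w p

/-- Errors are measured absolutely, or relative to the initial error. -/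
inductive ErrorCriterion : Type
  | absolute
  | normalized

/-- The factor by which the error threshold is multiplied. -/
def ErrorCriterion.scale (c : ErrorCriterion) (α : ℕ) (γ : ℕ → ℝ) (s : ℕ) : ℝ≥0∞ :=
  match c with
  | .absolute => 1
  | .normalized => minError α γ s 0

/-- The information complexity: the least `n` with minimal error at most `ε` (times the initial
error, for the normalized criterion), and `∞` if there is none. -/
def infoComplexity (c : ErrorCriterion) (α : ℕ) (γ : ℕ → ℝ) (s : ℕ) (ε : ℝ) : ℕ∞ :=
  ⨅ (n : ℕ) (_ : minError α γ s n ≤ ENNReal.ofReal ε * c.scale α γ s), (n : ℕ∞)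

/-- Strong polynomial tractability. -/
def SPT (c : ErrorCriterion) (α : ℕ) (γ : ℕ → ℝ) : Prop :=
  ∃ τ C : ℝ, 0 ≤ τ ∧ 0 ≤ C ∧ ∀ s : ℕ, 1 ≤ s → ∀ ε : ℝ, 0 < ε → ε < 1 →
    (infoComplexity c α γ s ε : ℝ≥0∞) ≤ ENNReal.ofReal (C * ε ^ (-τ))

/-- Polynomial tractability. -/
def PT (c : ErrorCriterion) (α : ℕ) (γ : ℕ → ℝ) : Prop :=
  ∃ τ σ C : ℝ, 0 ≤ τ ∧ 0 ≤ σ ∧ 0 ≤ C ∧ ∀ s : ℕ, 1 ≤ s → ∀ ε : ℝ, 0 < ε → ε < 1 →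
    (infoComplexity c α γ s ε : ℝ≥0∞) ≤ ENNReal.ofReal (C * ε ^ (-τ) * (s : ℝ) ^ σ)

/-- The limit `s + ε⁻¹ → ∞` over the pairs `(s, ε)` with `s ≥ 1` and `0 < ε < 1`. -/
def sizeAtTop : Filter (ℕ × ℝ) :=
  comap (fun q => (q.1 : ℝ) + q.2⁻¹) atTop ⊓ 𝓟 {q | 1 ≤ q.1 ∧ 0 < q.2 ∧ q.2 < 1}

/-- Weak tractability. -/
def WT (c : ErrorCriterion) (α : ℕ) (γ : ℕ → ℝ) : Prop :=
  Tendsto (fun q : ℕ × ℝ => ENNReal.log (infoComplexity c α γ q.1 q.2 : ℝ≥0∞) /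
    (((q.1 : ℝ) + q.2⁻¹ : ℝ) : EReal)) sizeAtTop (𝓝 0)

/-- `(σ, τ)`-weak tractability. -/
def STWT (c : ErrorCriterion) (α : ℕ) (γ : ℕ → ℝ) (σ τ : ℝ) : Prop :=
  Tendsto (fun q : ℕ × ℝ => ENNReal.log (infoComplexity c α γ q.1 q.2 : ℝ≥0∞) /
    (((q.1 : ℝ) ^ σ + q.2 ^ (-τ) : ℝ) : EReal)) sizeAtTop (𝓝 0)

/-- Uniform weak tractability. -/
def UWT (c : ErrorCriterion) (α : ℕ) (γ : ℕ → ℝ) : Prop :=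
  ∀ σ τ : ℝ, 0 < σ → σ ≤ 1 → 0 < τ → τ ≤ 1 → STWT c α γ σ τ

end AnchoredSpace

end

/-! Everything follows from a two-sided bound valid for both error criteria,
`exists_infoComplexity_eq`: `(1 - ε²) exp (c S) ≤ n(ε, s) ≤ 2 ε⁻² exp (C S)`, where `S = γ₁ + ⋯ +
γ_s` and the constants `c > 0`, `C ≥ 0` depend only on `α`. Each tractability notion then becomes a
growth condition on `S`.

Taylor's formula at `0` in every variable writes `f x` as an inner product of the anchored
derivatives of `f` with a tensor product of kernels (`IsDerivSystem.eq_sum_integral`). By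
Cauchy–Schwarz, the squared worst case error of a linear rule is at most `errorSq`, a weighted sum
of squared `L²` norms.

Upper bound (`minError_le`): for an equal-weight rule at independent Gaussian points, the mean of
`errorSq` is at most `1/n` times `∏ (1 + C γ_j) ≤ exp (C S)`. Here `C` collects double integrals of
squared Taylor kernels, finite because `α ≥ 2` (`integrable_kern_sq`).

Lower bound (`le_minError`): the representer of the integral is a product of one-variable functions.
Each factor splits orthogonally into a polynomial and two pieces, one for each half-line, vanishing
on the other (`component_eq_zero`). A tensor piece vanishes at a point as soon as one of its factors
belongs to the wrong half-line. The pieces that may survive at a given point carry at most the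
fraction `exp (-c S)` of the squared norm. Discarding those for all `n` points leaves a function
that vanishes at every point and keeps at least the fraction `1 - n exp (-c S)` of the squared
initial error. -/

noncomputable section

namespace AnchoredSpace

/-! ### Taylor's formula in one variable and square integrability of its kernel -/

/-- The standard Gaussian measure on the line. -/
abbrev stdGaussian : Measure ℝ := gaussianReal 0 1

/-- `q 0, …, q α` are the successive derivatives of a function of one variable: `q k` is locally
absolutely continuous with derivative `q (k + 1)` for `k < α`. -/
structure IsDerivChain (α : ℕ) (q : ℕ → ℝ → ℝ) : Prop where
  measurable : ∀ k ≤ α, Measurable (q k)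
  intervalIntegrable : ∀ k < α, ∀ a b, IntervalIntegrable (q (k + 1)) volume a b
  sub_eq_integral : ∀ k < α, ∀ a b, q k b - q k a = ∫ t in a..b, q (k + 1) t

/-- Integration by parts against a primitive of an integrable function. -/
theorem integral_mul_eq_of_primitive {u v v' : ℝ → ℝ} {x : ℝ} (hu : ContDiff ℝ 1 u)
    (hi : IntervalIntegrable v' volume 0 x)
    (hv : ∀ b, v b - v 0 = ∫ t in (0 : ℝ)..b, v' t) :
    ∫ t in (0 : ℝ)..x, u t * v' t = u x * v x - u 0 * v 0 - ∫ t in (0 : ℝ)..x, deriv u t * v t := by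
  have hv' : v = fun b => v 0 + ∫ t in (0 : ℝ)..b, v' t := by
    ext b; rw [← hv]; ring
  have hac : AbsolutelyContinuousOnInterval v 0 x := by
    have h1 : AbsolutelyContinuousOnInterval (fun _ : ℝ => v 0) 0 x :=
      (contDiff_const (n := 1)).contDiffOn.absolutelyContinuousOnInterval
    have h2 := hi.absolutelyContinuousOnInterval_intervalIntegral (c := 0) Set.left_mem_uIcc
    rw [hv']
    exact h1.add h2
  have hau : AbsolutelyContinuousOnInterval u 0 x := hu.contDiffOn.absolutelyContinuousOnInterval
  rw [← hau.integral_mul_deriv_eq_deriv_mul hac]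
  refine intervalIntegral.integral_congr_ae ?_
  filter_upwards [hi.ae_hasDerivAt_integral] with t ht htx
  have h3 := ht (Set.uIoc_subset_uIcc htx) 0 Set.left_mem_uIcc
  have h4 : deriv v t = v' t := by
    rw [hv']
    simpa using (h3.const_add (v 0)).deriv
  rw [h4]

/-- Integrating the next remainder by parts returns the present one together with one Taylor term.
Local absolute continuity is all that this needs. -/
theorem IsDerivChain.taylor {α : ℕ} {q : ℕ → ℝ → ℝ} (hq : IsDerivChain α q) (x : ℝ) (m : ℕ)
    (hm : m < α) :
    q 0 x = ∑ k ∈ Finset.range (m + 1), q k 0 * (x ^ k / k.factorial) +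
      ∫ t in (0 : ℝ)..x, (x - t) ^ m / m.factorial * q (m + 1) t := by
  induction m with
  | zero =>
    have := hq.sub_eq_integral 0 hm 0 x
    simp only [zero_add] at this
    simp [← this]
  | succ m ih =>
    rw [ih (by omega), Finset.sum_range_succ _ (m + 1)]
    have hd : ∀ t, deriv (fun t : ℝ => (x - t) ^ (m + 1) / (m + 1).factorial) t
        = -((x - t) ^ m / m.factorial) := by
      intro t
      have h1 : HasDerivAt (fun t : ℝ => x - t) (-1) t := by
        simpa using (hasDerivAt_id t).const_sub x
      have h2 := ((h1.pow (m + 1)).div_const ((m + 1).factorial : ℝ)).deriv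
      refine Eq.trans h2 ?_
      rw [Nat.factorial_succ]
      push_cast
      have : (m.factorial : ℝ) ≠ 0 := by positivity
      have : (m + 1 : ℝ) ≠ 0 := by positivity
      field_simp
    rw [integral_mul_eq_of_primitive (u := fun t : ℝ => (x - t) ^ (m + 1) / (m + 1).factorial)
      (v := q (m + 1)) (by fun_prop) (hq.intervalIntegrable (m + 1) hm 0 x)
      (fun b => hq.sub_eq_integral (m + 1) hm 0 b)]
    simp only [hd, neg_mul, intervalIntegral.integral_neg]
    simp
    ring

/-- The Taylor kernel of order `α`, with respect to the standard Gaussian measure: `x ^ k / k!` for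
`k < α`, and the truncated power divided by the Gaussian density for `k = α`. -/
def kern (α k : ℕ) (x t : ℝ) : ℝ :=
  if k < α then x ^ k / k.factorial
  else (if 0 < t ∧ t ≤ x then 1 else if x < t ∧ t ≤ 0 then -1 else 0) *
    ((x - t) ^ (α - 1) / (α - 1).factorial) / gaussianPDFReal 0 1 t

/-- The value `0` for derivatives of order `k < α`, and `t` for the highest derivative. -/
def anchor (α k : ℕ) (t : ℝ) : ℝ := if k < α then 0 else t

theorem measurable_kern (α k : ℕ) : Measurable fun p : ℝ × ℝ => kern α k p.1 p.2 := by
  unfold kern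
  split_ifs
  · fun_prop
  · have h1 : MeasurableSet {p : ℝ × ℝ | 0 < p.2 ∧ p.2 ≤ p.1} :=
      (measurableSet_lt measurable_const measurable_snd).inter
        (measurableSet_le measurable_snd measurable_fst)
    have h2 : MeasurableSet {p : ℝ × ℝ | p.1 < p.2 ∧ p.2 ≤ 0} :=
      (measurableSet_lt measurable_fst measurable_snd).inter
        (measurableSet_le measurable_snd measurable_const)
    have h3 : Measurable fun p : ℝ × ℝ => gaussianPDFReal 0 1 p.2 :=
      (measurable_gaussianPDFReal 0 1).comp measurable_snd
    refine Measurable.div (Measurable.mul ?_ (by fun_prop)) h3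
    exact Measurable.ite h1 measurable_const (Measurable.ite h2 measurable_const measurable_const)

theorem measurable_anchor (α k : ℕ) : Measurable (anchor α k) := by
  unfold anchor; split_ifs <;> fun_prop

/-- The density in the denominator of the kernel turns the Gaussian measure into Lebesgue measure,
and the value `-1` for `x < t ≤ 0` accounts for the orientation of the interval. The integrands
agree pointwise, so nothing is required of `F`. -/
theorem integral_kern_mul {α : ℕ} (x : ℝ) (F : ℝ → ℝ) :
    ∫ t, kern α α x t * F t ∂stdGaussian =
      ∫ t in (0 : ℝ)..x, (x - t) ^ (α - 1) / (α - 1).factorial * F t := by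
  have hφ : ∀ t, gaussianPDFReal 0 1 t ≠ 0 := fun t =>
    (gaussianPDFReal_pos 0 1 t one_ne_zero).ne'
  rw [integral_gaussianReal_eq_integral_smul one_ne_zero]
  rcases le_total 0 x with hx | hx
  · rw [intervalIntegral.integral_of_le hx, ← integral_indicator measurableSet_Ioc]
    congr 1 with t
    have := hφ t
    simp only [kern, lt_irrefl, if_false, Set.indicator, Set.mem_Ioc, smul_eq_mul]
    by_cases h : 0 < t ∧ t ≤ x
    · simp only [h, and_self, if_true]; field_simp
    · rw [if_neg h, if_neg h, if_neg (by intro h'; linarith)]; simp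
  · rw [intervalIntegral.integral_of_ge hx, ← integral_indicator measurableSet_Ioc, ← integral_neg]
    congr 1 with t
    have := hφ t
    simp only [kern, lt_irrefl, if_false, Set.indicator, Set.mem_Ioc, smul_eq_mul]
    rw [if_neg (by intro h'; linarith)]
    by_cases h : x < t ∧ t ≤ 0
    · simp only [h, and_self, if_true]; field_simp
    · rw [if_neg h, if_neg h]; simp

/-- For `k < α` the integrand does not depend on `t` and the measure has mass one. All Taylor terms
thus take the form of the remainder, which makes the formula ready for tensor products. -/
theorem IsDerivChain.eq_sum_integral {α : ℕ} {q : ℕ → ℝ → ℝ} (hα : 0 < α)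
    (hq : IsDerivChain α q) (x : ℝ) :
    q 0 x = ∑ k ∈ Finset.range (α + 1), ∫ t, kern α k x t * q k (anchor α k t) ∂stdGaussian := by
  obtain ⟨m, rfl⟩ : ∃ m, α = m + 1 := ⟨α - 1, by omega⟩
  rw [Finset.sum_range_succ, hq.taylor x m (by omega)]
  congr 1
  · refine Finset.sum_congr rfl fun k hk => ?_
    have hk := Finset.mem_range.1 hk
    simp [kern, anchor, hk, mul_comm]
  · simp only [anchor, lt_irrefl, if_false]
    rw [integral_kern_mul]
    simp

theorem gaussianPDFReal_le {x t : ℝ} (h : t ^ 2 ≤ x ^ 2) :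
    gaussianPDFReal 0 1 x ≤ gaussianPDFReal 0 1 t := by
  simp only [gaussianPDFReal, sub_zero]
  gcongr

/-- For fixed `x` the truncated power lives between `0` and `x`, where the density is at least its
value at `x`; the kernel is therefore bounded in `t`. -/
theorem memLp_kern (α k : ℕ) (x : ℝ) : MemLp (kern α k x) 2 stdGaussian := by
  have hm : Measurable (kern α k x) := (measurable_kern α k).comp measurable_prodMk_left
  have hpos : 0 < gaussianPDFReal 0 1 x := gaussianPDFReal_pos 0 1 x one_ne_zero
  refine MemLp.of_bound hm.aestronglyMeasurable
    (|x ^ k / k.factorial| + |x| ^ (α - 1) / gaussianPDFReal 0 1 x) (ae_of_all _ fun t => ?_)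
  have h0 : 0 ≤ |x| ^ (α - 1) / gaussianPDFReal 0 1 x := by positivity
  have h1 : (1 : ℝ) ≤ (α - 1).factorial := by exact_mod_cast (α - 1).factorial_pos
  rw [Real.norm_eq_abs]
  unfold kern
  split_ifs with h2 h3 h4
  · exact le_add_of_nonneg_right h0
  · refine le_add_of_nonneg_of_le (abs_nonneg _) ?_
    rw [abs_div, one_mul, abs_div, abs_pow, abs_of_pos (gaussianPDFReal_pos 0 1 t one_ne_zero),
      Nat.abs_cast]
    have h5 : |x - t| ≤ |x| := by
      rw [abs_of_nonneg (by linarith), abs_of_nonneg (by linarith)]; linarith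
    have h6 := gaussianPDFReal_le (x := x) (t := t) (by nlinarith)
    exact div_le_div₀ (by positivity) ((div_le_self (by positivity) h1).trans (by gcongr)) hpos h6
  · refine le_add_of_nonneg_of_le (abs_nonneg _) ?_
    rw [abs_div, neg_one_mul, abs_neg, abs_div, abs_pow,
      abs_of_pos (gaussianPDFReal_pos 0 1 t one_ne_zero), Nat.abs_cast]
    have h5 : |x - t| ≤ |x| := by
      rw [abs_of_nonpos (by linarith), abs_of_nonpos (by linarith)]; linarith
    have h6 := gaussianPDFReal_le (x := x) (t := t) (by nlinarith)
    exact div_le_div₀ (by positivity) ((div_le_self (by positivity) h1).trans (by gcongr)) hpos h6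
  · simp only [zero_mul, zero_div, abs_zero]; positivity

/-- With `z = t - x`, the left side is at most `z ^ (2m + 2) φ(x) / φ(t)`, and `φ(x) / φ(t) = exp (z
x + z² / 2)`. As `t` lies between `0` and `x`, `z² ≤ -z x`, so the exponent is at most `-z²/4 + z
x/4`. The second term gives decay in `z x`; a factor `z²` of the kernel, available because `α ≥ 2`,
converts it into decay in `x`. The bound is an integrable function of `x` times one of `t - x`. -/
theorem kern_sq_mul_le {m : ℕ} (x t : ℝ) :
    gaussianPDFReal 0 1 x * (gaussianPDFReal 0 1 t * kern (m + 2) (m + 2) x t ^ 2) ≤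
      (1 + x ^ 2)⁻¹ * (32 * ((1 + (t - x) ^ 2) * ((t - x) ^ (2 * m) *
        Real.exp (-(1 / 4) * (t - x) ^ 2)))) := by
  have hrhs : 0 ≤ (1 + x ^ 2)⁻¹ * (32 * ((1 + (t - x) ^ 2) * ((t - x) ^ (2 * m) *
        Real.exp (-(1 / 4) * (t - x) ^ 2)))) := by
    have : 0 ≤ (t - x) ^ (2 * m) := by rw [pow_mul]; positivity
    positivity
  have hφ := gaussianPDFReal_pos 0 1 t one_ne_zero
  -- `c` is the sign in the kernel; the second hypothesis says that `t` lies between `0` and `x`.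
  have key : ∀ c : ℝ, c ^ 2 = 1 → (t - x) ^ 2 ≤ (x - t) * x →
      gaussianPDFReal 0 1 x * (gaussianPDFReal 0 1 t * (c * ((x - t) ^ (m + 1) /
        ((m + 1).factorial : ℝ)) / gaussianPDFReal 0 1 t) ^ 2) ≤
      (1 + x ^ 2)⁻¹ * (32 * ((1 + (t - x) ^ 2) * ((t - x) ^ (2 * m) *
        Real.exp (-(1 / 4) * (t - x) ^ 2)))) := by
    intro c hc hz
    set z := t - x with hzdef
    have hxt : x - t = -z := by rw [hzdef]; ring
    rw [hxt] at hz ⊢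
    have hratio : gaussianPDFReal 0 1 x / gaussianPDFReal 0 1 t
        = Real.exp (-(-z * x - z ^ 2 / 2)) := by
      have ht : t = x + z := by rw [hzdef]; ring
      simp only [gaussianPDFReal, sub_zero]
      rw [mul_div_mul_left _ _ (by positivity), ← Real.exp_sub]
      congr 1
      rw [ht]; simp; ring
    have hu : 0 ≤ -z * x / 4 := by nlinarith [sq_nonneg z]
    have hexp : Real.exp (-(-z * x - z ^ 2 / 2)) ≤
        Real.exp (-(1 / 4) * z ^ 2) * Real.exp (-(-z * x / 4)) := by
      rw [← Real.exp_add]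
      gcongr
      linarith
    have hexp2 : Real.exp (-(-z * x / 4)) ≤ (1 + (z * x) ^ 2 / 32)⁻¹ := by
      rw [Real.exp_neg]
      gcongr
      have := Real.quadratic_le_exp_of_nonneg hu
      nlinarith
    have hfin : z ^ 2 * (1 + (z * x) ^ 2 / 32)⁻¹ ≤ (1 + x ^ 2)⁻¹ * (32 * (1 + z ^ 2)) := by
      rw [← div_eq_mul_inv, mul_comm _ (32 * _), ← div_eq_mul_inv, div_le_div_iff₀ (by positivity)
        (by positivity)]
      nlinarith [sq_nonneg z, sq_nonneg (z * x), sq_nonneg (z ^ 2 * x), sq_nonneg x]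
    have hfac : (1 : ℝ) ≤ ((m + 1).factorial : ℝ) ^ 2 := by
      have : (1 : ℝ) ≤ (m + 1).factorial := by exact_mod_cast (m + 1).factorial_pos
      nlinarith
    have hz2m : 0 ≤ z ^ (2 * m) := by rw [pow_mul]; positivity
    calc _ = gaussianPDFReal 0 1 x / gaussianPDFReal 0 1 t * (c ^ 2 * (z ^ (2 * m) * z ^ 2)) /
          ((m + 1).factorial : ℝ) ^ 2 := by
          have h1 : ((-z) ^ (m + 1)) ^ 2 = z ^ (2 * m) * z ^ 2 := by
            rw [← pow_mul, mul_comm (m + 1), pow_mul, neg_sq, pow_succ, ← pow_mul]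
          field_simp
          rw [h1]; ring
      _ ≤ gaussianPDFReal 0 1 x / gaussianPDFReal 0 1 t * (c ^ 2 * (z ^ (2 * m) * z ^ 2)) :=
          div_le_self (by rw [hratio]; positivity) hfac
      _ ≤ (Real.exp (-(1 / 4) * z ^ 2) * (1 + (z * x) ^ 2 / 32)⁻¹) * (z ^ (2 * m) * z ^ 2) := by
          rw [hratio, hc, one_mul]
          gcongr
          exact hexp.trans (by gcongr)
      _ = (Real.exp (-(1 / 4) * z ^ 2) * z ^ (2 * m)) * (z ^ 2 * (1 + (z * x) ^ 2 / 32)⁻¹) := by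
          ring
      _ ≤ (Real.exp (-(1 / 4) * z ^ 2) * z ^ (2 * m)) * ((1 + x ^ 2)⁻¹ * (32 * (1 + z ^ 2))) := by
          gcongr
      _ = _ := by ring
  unfold kern
  rw [if_neg (lt_irrefl _)]
  simp only [show m + 2 - 1 = m + 1 by omega]
  split_ifs with h1 h2
  · exact key 1 (by norm_num) (by nlinarith)
  · exact key (-1) (by norm_num) (by nlinarith)
  · simpa using hrhs

theorem integrable_pow_mul_exp_neg_sq (n : ℕ) :
    Integrable fun z : ℝ => z ^ n * Real.exp (-(1 / 4) * z ^ 2) := by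
  have := integrable_rpow_mul_exp_neg_mul_sq (b := 1 / 4) (by norm_num) (s := n)
    (by have : (0 : ℝ) ≤ n := n.cast_nonneg
        linarith)
  simpa only [Real.rpow_natCast] using this

theorem integrable_kern_sq {α k : ℕ} (hα : 1 < α) (hk : k ≤ α) :
    Integrable (fun p : ℝ × ℝ => kern α k p.1 p.2 ^ 2) (stdGaussian.prod stdGaussian) := by
  rcases hk.lt_or_eq with hk | rfl
  · have h1 : Integrable (fun x : ℝ => (x ^ k / k.factorial) ^ 2) stdGaussian := by
      have h2 : MemLp (id : ℝ → ℝ) (2 * k : ℕ) stdGaussian := by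
        have := memLp_id_gaussianReal (μ := 0) (v := 1) (2 * k : ℕ)
        simpa using this
      have h3 := h2.integrable_norm_pow'
      refine (h3.div_const ((k.factorial : ℝ) ^ 2)).congr (ae_of_all _ fun x => ?_)
      simp only [id, Real.norm_eq_abs]
      rw [pow_mul, sq_abs, div_pow, ← pow_mul, ← pow_mul, mul_comm]
    simpa [kern, hk] using h1.comp_fst stdGaussian
  · obtain ⟨m, rfl⟩ : ∃ m, k = m + 2 := ⟨k - 2, by omega⟩
    have hφ : Measurable (gaussianPDF 0 1) := measurable_gaussianPDF 0 1
    rw [stdGaussian, gaussianReal_of_var_ne_zero 0 one_ne_zero, prod_withDensity hφ hφ,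
      integrable_withDensity_iff_integrable_smul'
        (f := fun z : ℝ × ℝ => gaussianPDF 0 1 z.1 * gaussianPDF 0 1 z.2) (by fun_prop)
        (ae_of_all _ fun p => ENNReal.mul_lt_top ENNReal.ofReal_lt_top ENNReal.ofReal_lt_top)]
    have hg : Integrable fun z : ℝ => 32 * ((1 + z ^ 2) * (z ^ (2 * m) *
        Real.exp (-(1 / 4) * z ^ 2))) := by
      refine Integrable.const_mul ?_ 32
      refine ((integrable_pow_mul_exp_neg_sq (2 * m)).add
        (integrable_pow_mul_exp_neg_sq (2 * m + 2))).congr (ae_of_all _ fun z => ?_)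
      simp only [Pi.add_apply]; ring
    -- The majorant is the integrand of a convolution of two integrable functions, hence integrable
    -- on the plane.
    have hconv := (Integrable.convolution_integrand (ContinuousLinearMap.mul ℝ ℝ)
      integrable_inv_one_add_sq hg).swap
    refine hconv.mono' ?_ (ae_of_all _ fun p => ?_)
    · refine Measurable.aestronglyMeasurable ?_
      have := measurable_kern (m + 2) (m + 2)
      fun_prop
    · have h0 := gaussianPDFReal_nonneg 0 1
      rw [ENNReal.toReal_mul, gaussianPDF, gaussianPDF, ENNReal.toReal_ofReal (h0 _),
        ENNReal.toReal_ofReal (h0 _), smul_eq_mul, mul_assoc, Real.norm_of_nonneg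
          (mul_nonneg (h0 _) (mul_nonneg (h0 _) (sq_nonneg _)))]
      exact kern_sq_mul_le p.1 p.2

/-! ### Tensor products: recovering a function of several variables -/

section

instance (s : ℕ) : IsProbabilityMeasure (gaussian s) := by
  unfold gaussian; infer_instance

/-- The multiindices `{0, …, α} ^ s`. -/
abbrev multiIndices (α s : ℕ) : Finset (Fin s → ℕ) :=
  Fintype.piFinset fun _ : Fin s => Finset.range (α + 1)

theorem mem_multiIndices {α s : ℕ} {κ : Fin s → ℕ} : κ ∈ multiIndices α s ↔ ∀ j, κ j ≤ α := by
  simp [multiIndices, Fintype.mem_piFinset]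

theorem sum_multiIndices_succ {α s : ℕ} (F : (Fin (s + 1) → ℕ) → ℝ) :
    ∑ κ ∈ multiIndices α (s + 1), F κ =
      ∑ k ∈ Finset.range (α + 1), ∑ κ ∈ multiIndices α s, F (Fin.cons k κ) := by
  rw [← Finset.sum_product']
  refine Finset.sum_nbij' (fun κ => (κ 0, Fin.tail κ)) (fun p => Fin.cons p.1 p.2) ?_ ?_ ?_ ?_ ?_
  · intro κ hκ
    rw [mem_multiIndices] at hκ
    exact Finset.mem_product.2 ⟨Finset.mem_range.2 (Nat.lt_succ_of_le (hκ 0)),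
      mem_multiIndices.2 fun j => hκ j.succ⟩
  · rintro ⟨k, κ⟩ h
    obtain ⟨h1, h2⟩ := Finset.mem_product.1 h
    rw [mem_multiIndices] at h2 ⊢
    intro j
    refine Fin.cases ?_ (fun j => ?_) j
    · simpa using Nat.lt_succ_iff.1 (Finset.mem_range.1 h1)
    · simpa using h2 j
  · intro κ _; exact Fin.cons_self_tail κ
  · rintro ⟨k, κ⟩ _; simp
  · intro κ _; simp

theorem measurePreserving_cons (s : ℕ) :
    MeasurePreserving (fun p : ℝ × (Fin s → ℝ) => (Fin.cons p.1 p.2 : Fin (s + 1) → ℝ))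
      (stdGaussian.prod (gaussian s)) (gaussian (s + 1)) := by
  have h := (measurePreserving_piFinSuccAbove (fun _ : Fin (s + 1) => stdGaussian) 0).symm
  have h2 : ((MeasurableEquiv.piFinSuccAbove (fun _ : Fin (s + 1) => ℝ) 0).symm :
      ℝ × (Fin s → ℝ) → (Fin (s + 1) → ℝ)) = fun p => Fin.cons p.1 p.2 := by
    ext p j
    simp [MeasurableEquiv.piFinSuccAbove_symm_apply, Fin.insertNthEquiv]
  rw [h2] at h
  exact h

theorem measurableEmbedding_cons (s : ℕ) :
    MeasurableEmbedding (fun p : ℝ × (Fin s → ℝ) => (Fin.cons p.1 p.2 : Fin (s + 1) → ℝ)) := by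
  have h2 : ((MeasurableEquiv.piFinSuccAbove (fun _ : Fin (s + 1) => ℝ) 0).symm :
      ℝ × (Fin s → ℝ) → (Fin (s + 1) → ℝ)) = fun p => Fin.cons p.1 p.2 := by
    ext p j
    simp [MeasurableEquiv.piFinSuccAbove_symm_apply, Fin.insertNthEquiv]
  rw [← h2]
  exact MeasurableEquiv.measurableEmbedding _

theorem integrable_gaussian_succ {s : ℕ} {F : (Fin (s + 1) → ℝ) → ℝ} :
    Integrable (fun p : ℝ × (Fin s → ℝ) => F (Fin.cons p.1 p.2))
      (stdGaussian.prod (gaussian s)) ↔ Integrable F (gaussian (s + 1)) :=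
  (measurePreserving_cons s).integrable_comp_emb (measurableEmbedding_cons s)

theorem integral_gaussian_succ {s : ℕ} {F : (Fin (s + 1) → ℝ) → ℝ}
    (hF : Integrable F (gaussian (s + 1))) :
    ∫ x, F x ∂gaussian (s + 1) = ∫ t, ∫ y, F (Fin.cons t y) ∂gaussian s ∂stdGaussian := by
  rw [← (measurePreserving_cons s).integral_comp (measurableEmbedding_cons s),
    integral_prod _ (integrable_gaussian_succ.2 hF)]

theorem cons_add_single_zero {s : ℕ} (k : ℕ) (τ : Fin s → ℕ) :
    (Fin.cons k τ : Fin (s + 1) → ℕ) + Pi.single 0 1 = Fin.cons (k + 1) τ := by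
  ext j
  refine Fin.cases ?_ (fun j => ?_) j <;> simp

theorem cons_add_single_succ {s : ℕ} (k : ℕ) (τ : Fin s → ℕ) (j : Fin s) :
    (Fin.cons k τ : Fin (s + 1) → ℕ) + Pi.single j.succ 1 = Fin.cons k (τ + Pi.single j 1) := by
  ext i
  refine Fin.cases ?_ (fun i => ?_) i
  · simp
  · by_cases h : i = j
    · subst h; simp
    · simp [h]

theorem cons_le {s α k : ℕ} {τ : Fin s → ℕ} (hk : k ≤ α) (hτ : ∀ i, τ i ≤ α) (i : Fin (s + 1)) :
    (Fin.cons k τ : Fin (s + 1) → ℕ) i ≤ α := by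
  refine Fin.cases ?_ (fun i => ?_) i
  · simpa using hk
  · simpa using hτ i

section slices

variable {α s : ℕ} {f : (Fin (s + 1) → ℝ) → ℝ} {D : (Fin (s + 1) → ℕ) → (Fin (s + 1) → ℝ) → ℝ}

theorem IsDerivSystem.slice (hD : IsDerivSystem α f D) {k : ℕ} (hk : k ≤ α) (c : ℝ) :
    IsDerivSystem α (fun y : Fin s → ℝ => D (Fin.cons k 0) (Fin.cons c y))
      (fun τ y => D (Fin.cons k τ) (Fin.cons c y)) where
  zero := rfl
  measurable τ hτ := (hD.measurable _ (cons_le hk hτ)).comp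
    ((measurableEmbedding_cons s).measurable.comp measurable_prodMk_left)
  intervalIntegrable τ hτ j hj y a b := by
    have := hD.intervalIntegrable (Fin.cons k τ) (cons_le hk hτ) j.succ (by simpa using hj)
      (Fin.cons c y) a b
    simpa only [cons_add_single_succ, Fin.cons_update] using this
  sub_eq_integral τ hτ j hj y a b := by
    have := hD.sub_eq_integral (Fin.cons k τ) (cons_le hk hτ) j.succ (by simpa using hj)
      (Fin.cons c y) a b
    simpa only [cons_add_single_succ, Fin.cons_update] using this

theorem IsDerivSystem.isDerivChain (hD : IsDerivSystem α f D) (y : Fin s → ℝ) :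
    IsDerivChain α (fun k t => D (Fin.cons k 0) (Fin.cons t y)) where
  measurable k hk := (hD.measurable _ (cons_le hk fun _ => Nat.zero_le _)).comp
    ((measurableEmbedding_cons s).measurable.comp measurable_prodMk_right)
  intervalIntegrable k hk a b := by
    have := hD.intervalIntegrable (Fin.cons k 0) (cons_le hk.le fun _ => Nat.zero_le _) 0
      (by simpa using hk) (Fin.cons 0 y) a b
    simpa only [cons_add_single_zero, Fin.update_cons_zero] using this
  sub_eq_integral k hk a b := by
    have := hD.sub_eq_integral (Fin.cons k 0) (cons_le hk.le fun _ => Nat.zero_le _) 0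
      (by simpa using hk) (Fin.cons 0 y) a b
    simpa only [cons_add_single_zero, Fin.update_cons_zero] using this

end slices

/-- The tensor product of the Taylor kernels. -/
def tensorKern {s : ℕ} (α : ℕ) (κ : Fin s → ℕ) (x t : Fin s → ℝ) : ℝ :=
  ∏ j, kern α (κ j) (x j) (t j)

/-- The coordinatewise anchoring map. -/
def anchors {s : ℕ} (α : ℕ) (κ : Fin s → ℕ) (x : Fin s → ℝ) : Fin s → ℝ :=
  fun j => anchor α (κ j) (x j)

theorem measurable_anchors {s : ℕ} (α : ℕ) (κ : Fin s → ℕ) : Measurable (anchors α κ) :=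
  measurable_pi_lambda _ fun j => (measurable_anchor α (κ j)).comp (measurable_pi_apply j)

theorem anchors_cons {s : ℕ} (α k : ℕ) (κ : Fin s → ℕ) (t : ℝ) (y : Fin s → ℝ) :
    anchors α (Fin.cons k κ : Fin (s + 1) → ℕ) (Fin.cons t y) =
      Fin.cons (anchor α k t) (anchors α κ y) := by
  ext j
  refine Fin.cases ?_ (fun j => ?_) j <;> simp [anchors]

theorem tensorKern_cons {s : ℕ} (α k : ℕ) (κ : Fin s → ℕ) (x t : ℝ) (y z : Fin s → ℝ) :
    tensorKern α (Fin.cons k κ : Fin (s + 1) → ℕ) (Fin.cons x y) (Fin.cons t z) =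
      kern α k x t * tensorKern α κ y z := by
  simp [tensorKern, Fin.prod_univ_succ]

theorem measurable_tensorKern {s : ℕ} (α : ℕ) (κ : Fin s → ℕ) :
    Measurable fun p : (Fin s → ℝ) × (Fin s → ℝ) => tensorKern α κ p.1 p.2 := by
  unfold tensorKern
  refine Finset.measurable_prod _ fun j _ => ?_
  exact (measurable_kern α (κ j)).comp (by fun_prop : Measurable
    fun p : (Fin s → ℝ) × (Fin s → ℝ) => (p.1 j, p.2 j))

theorem measurable_tensorKern_right {s : ℕ} (α : ℕ) (κ : Fin s → ℕ) (x : Fin s → ℝ) :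
    Measurable (tensorKern α κ x) :=
  (measurable_tensorKern α κ).comp measurable_prodMk_left

theorem integrable_tensorKern_sq_right {s : ℕ} (α : ℕ) (κ : Fin s → ℕ) (x : Fin s → ℝ) :
    Integrable (fun t => tensorKern α κ x t ^ 2) (gaussian s) := by
  simp only [tensorKern, ← Finset.prod_pow]
  exact Integrable.fintype_prod fun j => (memLp_kern α (κ j) (x j)).integrable_sq

theorem memLp_tensorKern {s : ℕ} (α : ℕ) (κ : Fin s → ℕ) (x : Fin s → ℝ) :
    MemLp (tensorKern α κ x) 2 (gaussian s) :=
  (memLp_two_iff_integrable_sq (measurable_tensorKern_right α κ x).aestronglyMeasurable).2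
    (integrable_tensorKern_sq_right α κ x)

/-- A function is recovered from the anchored traces of its derivatives, if these are square
integrable. -/
theorem IsDerivSystem.eq_sum_integral {α : ℕ} (hα : 0 < α) {s : ℕ} {f : (Fin s → ℝ) → ℝ}
    {D : (Fin s → ℕ) → (Fin s → ℝ) → ℝ} (hD : IsDerivSystem α f D)
    (hfin : ∀ κ, (∀ i, κ i ≤ α) → Integrable (fun t => D κ (anchors α κ t) ^ 2) (gaussian s))
    (x : Fin s → ℝ) :
    f x = ∑ κ ∈ multiIndices α s, ∫ t, tensorKern α κ x t * D κ (anchors α κ t) ∂gaussian s := by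
  induction s with
  | zero =>
    have h1 : multiIndices α 0 = {0} := by
      refine Finset.eq_singleton_iff_unique_mem.2 ⟨mem_multiIndices.2 fun j => j.elim0,
        fun κ _ => Subsingleton.elim _ _⟩
    have h2 : ∀ t, tensorKern α 0 x t * f (anchors α 0 t) = f x := fun t => by
      rw [Subsingleton.elim (anchors α 0 t) x, tensorKern, Fin.prod_univ_zero, one_mul]
    rw [h1, Finset.sum_singleton, hD.zero]
    simp only [h2, integral_const, probReal_univ, one_smul]
  | succ s ih =>
    obtain ⟨x₀, y, rfl⟩ : ∃ x₀ y, x = (Fin.cons x₀ y : Fin (s + 1) → ℝ) :=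
      ⟨x 0, Fin.tail x, (Fin.cons_self_tail x).symm⟩
    have hint : ∀ κ, (∀ i, κ i ≤ α) → Integrable
        (fun t => tensorKern α κ (Fin.cons x₀ y) t * D κ (anchors α κ t)) (gaussian (s + 1)) := by
      intro κ hκ
      refine (memLp_tensorKern α κ _).integrable_mul
        ((memLp_two_iff_integrable_sq ?_).2 (hfin κ hκ))
      exact ((hD.measurable κ hκ).comp (measurable_anchors α κ)).aestronglyMeasurable
    have h0 := (hD.isDerivChain y).eq_sum_integral hα x₀
    have hz : (Fin.cons 0 0 : Fin (s + 1) → ℕ) = 0 := by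
      ext j; refine Fin.cases ?_ (fun j => ?_) j <;> simp
    simp only [hz, hD.zero] at h0
    rw [h0, sum_multiIndices_succ]
    refine Finset.sum_congr rfl fun k hk => ?_
    have hk : k ≤ α := Nat.lt_succ_iff.1 (Finset.mem_range.1 hk)
    -- For `k = α` the first variable is not anchored, and by Fubini its slices have square
    -- integrable traces only for almost every `t`. This is enough, because the induction hypothesis
    -- is used under an integral in `t`.
    have hslice : ∀ᵐ t ∂stdGaussian, ∀ κ ∈ multiIndices α s, Integrable
        (fun z => D (Fin.cons k κ) (Fin.cons (anchor α k t) (anchors α κ z)) ^ 2) (gaussian s) := by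
      rw [Finset.eventually_all]
      intro κ hκ
      have h1 := integrable_gaussian_succ.2
        (hfin (Fin.cons k κ) (cons_le hk (mem_multiIndices.1 hκ)))
      simp only [anchors_cons] at h1
      exact h1.prod_right_ae
    have hprod : ∀ κ ∈ multiIndices α s, Integrable (fun p : ℝ × (Fin s → ℝ) =>
        kern α k x₀ p.1 * tensorKern α κ y p.2 *
          D (Fin.cons k κ) (Fin.cons (anchor α k p.1) (anchors α κ p.2)))
        (stdGaussian.prod (gaussian s)) := by
      intro κ hκ
      have h1 := integrable_gaussian_succ.2
        (hint (Fin.cons k κ) (cons_le hk (mem_multiIndices.1 hκ)))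
      simpa only [anchors_cons, tensorKern_cons] using h1
    calc ∫ t, kern α k x₀ t * D (Fin.cons k 0) (Fin.cons (anchor α k t) y) ∂stdGaussian
        = ∫ t, ∑ κ ∈ multiIndices α s, ∫ z, kern α k x₀ t * tensorKern α κ y z *
          D (Fin.cons k κ) (Fin.cons (anchor α k t) (anchors α κ z)) ∂gaussian s ∂stdGaussian := by
          refine integral_congr_ae ?_
          filter_upwards [hslice] with t ht
          have h2 := ih (hD.slice hk (anchor α k t)) (fun κ hκ => ht κ (mem_multiIndices.2 hκ)) y
          rw [h2, Finset.mul_sum]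
          refine Finset.sum_congr rfl fun κ _ => ?_
          rw [← integral_const_mul]
          simp only [mul_assoc]
      _ = ∑ κ ∈ multiIndices α s, ∫ t, ∫ z, kern α k x₀ t * tensorKern α κ y z *
          D (Fin.cons k κ) (Fin.cons (anchor α k t) (anchors α κ z)) ∂gaussian s ∂stdGaussian :=
          integral_finsetSum _ fun κ hκ => (hprod κ hκ).integral_prod_left
      _ = _ := by
          refine Finset.sum_congr rfl fun κ hκ => ?_
          rw [integral_gaussian_succ (hint (Fin.cons k κ) (cons_le hk (mem_multiIndices.1 hκ)))]
          simp only [anchors_cons, tensorKern_cons]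

end

/-! ### Upper bound: Cauchy–Schwarz and random points -/

section

section general

variable {X T : Type*} [MeasurableSpace X] [MeasurableSpace T] {μ : Measure X} {ν : Measure T}

/-- The deviation from the mean integrates to zero, so the cross term with the constant `a` drops
out. -/
theorem integral_add_sub_mean_sq [IsProbabilityMeasure μ] {g : X → ℝ} (hg : MemLp g 2 μ) (a : ℝ) :
    Integrable (fun x => (a + (g x - ∫ y, g y ∂μ)) ^ 2) μ ∧
    ∫ x, (a + (g x - ∫ y, g y ∂μ)) ^ 2 ∂μ = a ^ 2 + ∫ x, g x ^ 2 ∂μ - (∫ x, g x ∂μ) ^ 2 := by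
  set m := ∫ y, g y ∂μ with hm
  have h1 := hg.integrable one_le_two
  have h2 := hg.integrable_sq
  have h3 : (fun x => (a + (g x - m)) ^ 2) =
      fun x => (g x ^ 2 + 2 * (a - m) * g x) + (a - m) ^ 2 := by ext x; ring
  have h4 := h1.const_mul (2 * (a - m))
  have h5 : Integrable (fun x => g x ^ 2 + 2 * (a - m) * g x) μ := h2.add h4
  rw [h3]
  refine ⟨h5.add (integrable_const _), ?_⟩
  rw [integral_add h5 (integrable_const _), integral_add h2 h4, integral_const_mul, ← hm]
  simp; ring

theorem sq_integral_le [IsProbabilityMeasure μ] {g : X → ℝ} (hg : MemLp g 2 μ) :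
    (∫ x, g x ∂μ) ^ 2 ≤ ∫ x, g x ^ 2 ∂μ := by
  obtain ⟨-, h⟩ := integral_add_sub_mean_sq hg 0
  have := integral_nonneg (μ := μ) (f := fun x => (0 + (g x - ∫ y, g y ∂μ)) ^ 2)
    fun x => sq_nonneg _
  linarith

theorem lintegral_add_sub_mean_sq_le [IsProbabilityMeasure μ] {g : X → ℝ} (hg : Measurable g)
    (a : ℝ) :
    ∫⁻ x, ENNReal.ofReal ((a + (g x - ∫ y, g y ∂μ)) ^ 2) ∂μ ≤
      ENNReal.ofReal (a ^ 2) + ∫⁻ x, ENNReal.ofReal (g x ^ 2) ∂μ := by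
  by_cases h : ∫⁻ x, ENNReal.ofReal (g x ^ 2) ∂μ = ⊤
  · simp [h]
  have h1 : Integrable (fun x => g x ^ 2) μ :=
    (lintegral_ofReal_ne_top_iff_integrable (hg.pow_const 2).aestronglyMeasurable
      (ae_of_all _ fun x => sq_nonneg _)).1 h
  have h2 := (memLp_two_iff_integrable_sq hg.aestronglyMeasurable).2 h1
  obtain ⟨h3, h4⟩ := integral_add_sub_mean_sq h2 a
  rw [← ofReal_integral_eq_lintegral_ofReal h3 (ae_of_all _ fun x => sq_nonneg _),
    ← ofReal_integral_eq_lintegral_ofReal h1 (ae_of_all _ fun x => sq_nonneg _), h4,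
    ← ENNReal.ofReal_add (sq_nonneg _) (integral_nonneg fun x => sq_nonneg _)]
  exact ENNReal.ofReal_le_ofReal (by linarith [sq_nonneg (∫ x, g x ∂μ)])

/-- By Jensen's inequality in `x`, the square of the mean is at most the mean of the square, which
Fubini makes integrable in `t`. -/
theorem integrable_sq_integral [IsProbabilityMeasure μ] [SFinite ν] {K : X → T → ℝ}
    (hK : Measurable fun p : X × T => K p.1 p.2)
    (h : Integrable (fun p : X × T => K p.1 p.2 ^ 2) (μ.prod ν)) :
    Integrable (fun t => (∫ x, K x t ∂μ) ^ 2) ν := by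
  have hm : StronglyMeasurable fun t => ∫ x, K x t ∂μ :=
    StronglyMeasurable.integral_prod_left (f := K) hK.stronglyMeasurable
  refine h.integral_prod_right.mono' (hm.measurable.pow_const 2).aestronglyMeasurable ?_
  filter_upwards [h.prod_left_ae] with t ht
  rw [Real.norm_of_nonneg (sq_nonneg _)]
  exact sq_integral_le ((memLp_two_iff_integrable_sq
    (hK.comp measurable_prodMk_right).aestronglyMeasurable).2 ht)

variable {ι : Type*}

/-- The total square deviation of a sum of `n` kernel sections from its mean can be kept below the
expected value for independent random points. -/
theorem exists_points_sum_lintegral_le [IsProbabilityMeasure μ] [SFinite ν] (K : Finset ι)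
    (c : ι → ℝ≥0∞) (Ψ : ι → X → T → ℝ) (hΨ : ∀ κ, Measurable fun p : X × T => Ψ κ p.1 p.2) (n : ℕ) :
    ∃ p : Fin n → X,
      ∑ κ ∈ K, c κ * ∫⁻ t, ENNReal.ofReal ((∑ i, (Ψ κ (p i) t - ∫ x, Ψ κ x t ∂μ)) ^ 2) ∂ν ≤
        n * ∑ κ ∈ K, c κ * ∫⁻ t, ∫⁻ x, ENNReal.ofReal (Ψ κ x t ^ 2) ∂μ ∂ν := by
  have hmean : ∀ κ, Measurable fun t => ∫ x, Ψ κ x t ∂μ := fun κ =>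
    (StronglyMeasurable.integral_prod_left (f := Ψ κ) (hΨ κ).stronglyMeasurable).measurable
  induction n with
  | zero => exact ⟨Fin.elim0, by simp⟩
  | succ n ih =>
    obtain ⟨p, hp⟩ := ih
    set S : ι → T → ℝ := fun κ t => ∑ i, (Ψ κ (p i) t - ∫ x, Ψ κ x t ∂μ) with hS
    have hSm : ∀ κ, Measurable (S κ) := fun κ => Finset.measurable_sum _ fun i _ =>
      ((hΨ κ).comp measurable_prodMk_left).sub (hmean κ)
    have hFm : ∀ κ, Measurable fun q : X × T =>
        ENNReal.ofReal ((S κ q.2 + (Ψ κ q.1 q.2 - ∫ x, Ψ κ x q.2 ∂μ)) ^ 2) := fun κ =>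
      ENNReal.measurable_ofReal.comp ((((hSm κ).comp measurable_snd).add
        ((hΨ κ).sub ((hmean κ).comp measurable_snd))).pow_const 2)
    have hGm : ∀ κ, Measurable fun y : X =>
        ∫⁻ t, ENNReal.ofReal ((S κ t + (Ψ κ y t - ∫ x, Ψ κ x t ∂μ)) ^ 2) ∂ν := fun κ =>
      (hFm κ).lintegral_prod_right'
    -- The points are chosen one at a time: some new point `y` does no worse than the average over
    -- `μ`.
    obtain ⟨y, hy⟩ := exists_le_lintegral (μ := μ) (f := fun y => ∑ κ ∈ K, c κ *
      ∫⁻ t, ENNReal.ofReal ((S κ t + (Ψ κ y t - ∫ x, Ψ κ x t ∂μ)) ^ 2) ∂ν)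
      (Finset.measurable_sum _ fun κ _ => (hGm κ).const_mul _).aemeasurable
    refine ⟨Fin.cons y p, ?_⟩
    calc _ = ∑ κ ∈ K, c κ *
          ∫⁻ t, ENNReal.ofReal ((S κ t + (Ψ κ y t - ∫ x, Ψ κ x t ∂μ)) ^ 2) ∂ν := by
          simp only [Fin.sum_univ_succ, Fin.cons_zero, Fin.cons_succ, hS]
          simp only [add_comm]
      _ ≤ _ := hy
      _ = ∑ κ ∈ K, c κ * ∫⁻ t, ∫⁻ y,
          ENNReal.ofReal ((S κ t + (Ψ κ y t - ∫ x, Ψ κ x t ∂μ)) ^ 2) ∂μ ∂ν := by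
          rw [lintegral_finsetSum _ fun κ _ => (hGm κ).const_mul _]
          refine Finset.sum_congr rfl fun κ _ => ?_
          rw [lintegral_const_mul _ (hGm κ), lintegral_lintegral_swap (hFm κ).aemeasurable]
      -- The increment has mean zero in `y`, so on average a new point only adds its own second
      -- moment.
      _ ≤ ∑ κ ∈ K, c κ * ∫⁻ t, (ENNReal.ofReal (S κ t ^ 2) +
            ∫⁻ x, ENNReal.ofReal (Ψ κ x t ^ 2) ∂μ) ∂ν := by
          gcongr with κ _ t
          exact lintegral_add_sub_mean_sq_le ((hΨ κ).comp measurable_prodMk_right) _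
      _ = ∑ κ ∈ K, c κ * ∫⁻ t, ENNReal.ofReal (S κ t ^ 2) ∂ν +
            ∑ κ ∈ K, c κ * ∫⁻ t, ∫⁻ x, ENNReal.ofReal (Ψ κ x t ^ 2) ∂μ ∂ν := by
          rw [← Finset.sum_add_distrib]
          refine Finset.sum_congr rfl fun κ _ => ?_
          rw [lintegral_add_left ((hSm κ).pow_const 2).ennreal_ofReal, mul_add]
      _ ≤ n * ∑ κ ∈ K, c κ * ∫⁻ t, ∫⁻ x, ENNReal.ofReal (Ψ κ x t ^ 2) ∂μ ∂ν +
            ∑ κ ∈ K, c κ * ∫⁻ t, ∫⁻ x, ENNReal.ofReal (Ψ κ x t ^ 2) ∂μ ∂ν := by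
          gcongr
      _ = _ := by push_cast; ring

/-- The Cauchy–Schwarz inequality for a finite weighted sum of `L²` spaces. -/
theorem sq_sum_integral_mul_le (K : Finset ι) {c : ι → ℝ} (hc : ∀ κ, 0 < c κ) {E G : ι → T → ℝ}
    (hE : ∀ κ ∈ K, MemLp (E κ) 2 ν) (hG : ∀ κ ∈ K, MemLp (G κ) 2 ν)
    (hN : ∑ κ ∈ K, (c κ)⁻¹ * ∫ t, G κ t ^ 2 ∂ν ≤ 1) :
    (∑ κ ∈ K, ∫ t, E κ t * G κ t ∂ν) ^ 2 ≤ ∑ κ ∈ K, c κ * ∫ t, E κ t ^ 2 ∂ν := by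
  have key : ∀ x, 2 * x * ∑ κ ∈ K, ∫ t, E κ t * G κ t ∂ν ≤
      x ^ 2 * (∑ κ ∈ K, (c κ)⁻¹ * ∫ t, G κ t ^ 2 ∂ν) + ∑ κ ∈ K, c κ * ∫ t, E κ t ^ 2 ∂ν := by
    intro x
    rw [Finset.mul_sum, Finset.mul_sum, ← Finset.sum_add_distrib]
    refine Finset.sum_le_sum fun κ hκ => ?_
    have h1 : Integrable (fun t => E κ t * G κ t) ν := (hE κ hκ).integrable_mul (hG κ hκ)
    have h2 := (hE κ hκ).integrable_sq
    have h3 := (hG κ hκ).integrable_sq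
    rw [← integral_const_mul, ← integral_const_mul, ← integral_const_mul, ← integral_const_mul,
      ← integral_add ((h3.const_mul _).const_mul _) (h2.const_mul _)]
    refine integral_mono (h1.const_mul _) (((h3.const_mul _).const_mul _).add (h2.const_mul _))
      fun t => ?_
    have hc0 := hc κ
    have h5 : x ^ 2 * ((c κ)⁻¹ * G κ t ^ 2) + c κ * E κ t ^ 2 - 2 * x * (E κ t * G κ t) =
        (c κ)⁻¹ * (x * G κ t - c κ * E κ t) ^ 2 := by field_simp; ring
    have h6 : 0 ≤ (c κ)⁻¹ * (x * G κ t - c κ * E κ t) ^ 2 := by positivity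
    linarith
  -- Taking `x` to be the inner product `B` itself gives `2 B² ≤ B² + ∑ c ‖E‖²`.
  set x := ∑ κ ∈ K, ∫ t, E κ t * G κ t ∂ν
  nlinarith [key x, mul_le_mul_of_nonneg_left hN (sq_nonneg x)]

end general

/-- The mean of the Taylor kernel. -/
def meanKern (α k : ℕ) (t : ℝ) : ℝ := ∫ x, kern α k x t ∂stdGaussian

theorem measurable_meanKern (α k : ℕ) : Measurable (meanKern α k) :=
  (StronglyMeasurable.integral_prod_left (f := kern α k)
    (measurable_kern α k).stronglyMeasurable).measurable

theorem memLp_meanKern {α k : ℕ} (hα : 1 < α) (hk : k ≤ α) :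
    MemLp (meanKern α k) 2 stdGaussian :=
  (memLp_two_iff_integrable_sq (measurable_meanKern α k).aestronglyMeasurable).2
    (integrable_sq_integral (measurable_kern α k) (integrable_kern_sq hα hk))

/-- The weight attached to the derivative of order `k` in a variable of weight `g`. -/
def weight (g : ℝ) (k : ℕ) : ℝ := if k = 0 then 1 else g

theorem weight_pos {g : ℝ} (hg : 0 < g) (k : ℕ) : 0 < weight g k := by
  unfold weight; split_ifs <;> simp [hg]

variable {α s : ℕ}

theorem integral_tensorKern (κ : Fin s → ℕ) (t : Fin s → ℝ) :
    ∫ x, tensorKern α κ x t ∂gaussian s = ∏ j, meanKern α (κ j) (t j) := by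
  simp only [tensorKern, gaussian]
  exact integral_fintype_prod_eq_prod (fun j x => kern α (κ j) x (t j))

theorem integral_tensorKern_sq_right (κ : Fin s → ℕ) (x : Fin s → ℝ) :
    ∫ t, tensorKern α κ x t ^ 2 ∂gaussian s =
      ∏ j, ∫ t, kern α (κ j) (x j) t ^ 2 ∂stdGaussian := by
  simp only [tensorKern, ← Finset.prod_pow, gaussian]
  exact integral_fintype_prod_eq_prod (fun j t => kern α (κ j) (x j) t ^ 2)

theorem integrable_tensorKern_sq (hα : 1 < α) {κ : Fin s → ℕ} (hκ : ∀ j, κ j ≤ α) :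
    Integrable (fun p : (Fin s → ℝ) × (Fin s → ℝ) => tensorKern α κ p.1 p.2 ^ 2)
      ((gaussian s).prod (gaussian s)) := by
  have hm := (measurable_tensorKern α κ).pow_const 2
  refine (integrable_prod_iff hm.aestronglyMeasurable).2
    ⟨ae_of_all _ fun x => integrable_tensorKern_sq_right α κ x, ?_⟩
  have h1 : ∀ x t : Fin s → ℝ, ‖tensorKern α κ x t ^ 2‖ = tensorKern α κ x t ^ 2 :=
    fun x t => Real.norm_of_nonneg (sq_nonneg _)
  simp only [h1, integral_tensorKern_sq_right]
  exact Integrable.fintype_prod (f := fun j x => ∫ t, kern α (κ j) x t ^ 2 ∂stdGaussian)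
    fun j => (integrable_kern_sq hα (hκ j)).integral_prod_left

theorem integral_tensorKern_sq (κ : Fin s → ℕ) :
    ∫ x, ∫ t, tensorKern α κ x t ^ 2 ∂gaussian s ∂gaussian s =
      ∏ j, ∫ x, ∫ t, kern α (κ j) x t ^ 2 ∂stdGaussian ∂stdGaussian := by
  simp only [integral_tensorKern_sq_right]
  exact integral_fintype_prod_eq_prod (fun j x => ∫ t, kern α (κ j) x t ^ 2 ∂stdGaussian)

theorem memLp_prod_meanKern (hα : 1 < α) {κ : Fin s → ℕ} (hκ : ∀ j, κ j ≤ α) :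
    MemLp (fun t : Fin s → ℝ => ∏ j, meanKern α (κ j) (t j)) 2 (gaussian s) := by
  have hm : Measurable fun t : Fin s → ℝ => ∏ j, meanKern α (κ j) (t j) :=
    Finset.measurable_prod _ fun j _ => (measurable_meanKern α (κ j)).comp (measurable_pi_apply j)
  refine (memLp_two_iff_integrable_sq hm.aestronglyMeasurable).2 ?_
  simp only [← Finset.prod_pow]
  exact Integrable.fintype_prod (f := fun j t => meanKern α (κ j) t ^ 2)
    fun j => (memLp_meanKern hα (hκ j)).integrable_sq

/-- The squared worst case error of a linear algorithm. -/
def errorSq (α : ℕ) (γ : ℕ → ℝ) (s : ℕ) {n : ℕ} (w : Fin n → ℝ) (p : Fin n → Fin s → ℝ) : ℝ :=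
  ∑ κ ∈ multiIndices α s, (∏ j : Fin s, weight (γ j) (κ j)) *
    ∫ t, (∏ j, meanKern α (κ j) (t j) - ∑ i, w i * tensorKern α κ (p i) t) ^ 2 ∂gaussian s

theorem normSq_eq (α : ℕ) (γ : ℕ → ℝ) (D : (Fin s → ℕ) → (Fin s → ℝ) → ℝ) :
    normSq α γ D = ∑ κ ∈ multiIndices α s,
      ENNReal.ofReal (∏ j : Fin s, weight (γ j) (κ j))⁻¹ *
        ∫⁻ x, ENNReal.ofReal (D κ (anchors α κ x) ^ 2) ∂gaussian s := rfl

theorem integrable_of_normSq_ne_top {γ : ℕ → ℝ} (hγ : ∀ j, 0 < γ j) {f : (Fin s → ℝ) → ℝ}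
    {D : (Fin s → ℕ) → (Fin s → ℝ) → ℝ} (hD : IsDerivSystem α f D) (hN : normSq α γ D ≠ ⊤)
    (κ : Fin s → ℕ) (hκ : ∀ i, κ i ≤ α) :
    Integrable (fun t => D κ (anchors α κ t) ^ 2) (gaussian s) := by
  have hm := (hD.measurable κ hκ).comp (measurable_anchors α κ)
  refine (lintegral_ofReal_ne_top_iff_integrable (hm.pow_const 2).aestronglyMeasurable
      (ae_of_all _ fun x => sq_nonneg _)).1 fun h => hN ?_
  rw [normSq_eq, ENNReal.sum_eq_top]
  refine ⟨κ, mem_multiIndices.2 hκ, ?_⟩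
  have h1 : 0 < (∏ j : Fin s, weight (γ j) (κ j))⁻¹ :=
    inv_pos.2 (Finset.prod_pos fun j _ => weight_pos (hγ j) _)
  have h2 : ∫⁻ x, ENNReal.ofReal (D κ (anchors α κ x) ^ 2) ∂gaussian s = ⊤ := h
  rw [h2, ENNReal.mul_top (ENNReal.ofReal_pos.2 h1).ne']

theorem normSq_eq_ofReal {γ : ℕ → ℝ} (hγ : ∀ j, 0 < γ j) {D : (Fin s → ℕ) → (Fin s → ℝ) → ℝ}
    (h : ∀ κ, (∀ i, κ i ≤ α) → Integrable (fun t => D κ (anchors α κ t) ^ 2) (gaussian s)) :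
    normSq α γ D = ENNReal.ofReal (∑ κ ∈ multiIndices α s,
      (∏ j : Fin s, weight (γ j) (κ j))⁻¹ * ∫ x, D κ (anchors α κ x) ^ 2 ∂gaussian s) := by
  have h1 : ∀ κ : Fin s → ℕ, 0 ≤ (∏ j : Fin s, weight (γ j) (κ j))⁻¹ := fun κ =>
    inv_nonneg.2 (Finset.prod_nonneg fun j _ => (weight_pos (hγ j) _).le)
  rw [normSq_eq, ENNReal.ofReal_sum_of_nonneg fun κ _ =>
    mul_nonneg (h1 κ) (integral_nonneg fun x => sq_nonneg _)]
  refine Finset.sum_congr rfl fun κ hκ => ?_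
  rw [ENNReal.ofReal_mul (h1 κ), ofReal_integral_eq_lintegral_ofReal (h κ (mem_multiIndices.1 hκ))
    (ae_of_all _ fun x => sq_nonneg _)]

theorem memLp_error (hα : 1 < α) {n : ℕ} (w : Fin n → ℝ) (p : Fin n → Fin s → ℝ)
    {κ : Fin s → ℕ} (hκ : ∀ j, κ j ≤ α) :
    MemLp (fun t => ∏ j, meanKern α (κ j) (t j) - ∑ i, w i * tensorKern α κ (p i) t) 2
      (gaussian s) :=
  (memLp_prod_meanKern hα hκ).sub
    (memLp_finsetSum _ fun i _ => (memLp_tensorKern α κ (p i)).const_mul (w i))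

/-- Fubini turns the integral of the Taylor formula into an inner product with the product of mean
kernels. The error is then an inner product of the derivatives of `f` with mean kernel minus
quadrature of the kernel, and Cauchy–Schwarz applies. -/
theorem sq_error_le (hα : 1 < α) {γ : ℕ → ℝ} (hγ : ∀ j, 0 < γ j) {f : (Fin s → ℝ) → ℝ}
    (hf : f ∈ unitBall α γ s) {n : ℕ} (w : Fin n → ℝ) (p : Fin n → Fin s → ℝ) :
    (∫ x, f x ∂gaussian s - ∑ i, w i * f (p i)) ^ 2 ≤ errorSq α γ s w p := by
  obtain ⟨D, hD, hN⟩ := hf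
  have hfin := integrable_of_normSq_ne_top hγ hD (ne_top_of_le_ne_top ENNReal.one_ne_top hN)
  have hrep := hD.eq_sum_integral (zero_lt_one.trans hα) hfin
  have hG : ∀ κ ∈ multiIndices α s, MemLp (fun t => D κ (anchors α κ t)) 2 (gaussian s) := by
    intro κ hκ
    exact (memLp_two_iff_integrable_sq ((hD.measurable κ (mem_multiIndices.1 hκ)).comp
      (measurable_anchors α κ)).aestronglyMeasurable).2 (hfin κ (mem_multiIndices.1 hκ))
  have hprod : ∀ κ ∈ multiIndices α s, Integrable (fun q : (Fin s → ℝ) × (Fin s → ℝ) =>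
      tensorKern α κ q.1 q.2 * D κ (anchors α κ q.2)) ((gaussian s).prod (gaussian s)) := by
    intro κ hκ
    exact MemLp.integrable_mul (p := 2) (q := 2) ((memLp_two_iff_integrable_sq
      (measurable_tensorKern α κ).aestronglyMeasurable).2
      (integrable_tensorKern_sq hα (mem_multiIndices.1 hκ))) ((hG κ hκ).comp_snd (gaussian s))
  have hint : ∫ x, f x ∂gaussian s = ∑ κ ∈ multiIndices α s,
      ∫ t, (∏ j, meanKern α (κ j) (t j)) * D κ (anchors α κ t) ∂gaussian s := by
    simp only [hrep]
    rw [integral_finsetSum _ fun κ hκ => (hprod κ hκ).integral_prod_left]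
    refine Finset.sum_congr rfl fun κ hκ => ?_
    rw [integral_integral_swap (hprod κ hκ)]
    simp only [integral_mul_const, integral_tensorKern]
  have herr : ∫ x, f x ∂gaussian s - ∑ i, w i * f (p i) = ∑ κ ∈ multiIndices α s,
      ∫ t, (∏ j, meanKern α (κ j) (t j) - ∑ i, w i * tensorKern α κ (p i) t) *
        D κ (anchors α κ t) ∂gaussian s := by
    have h2 : ∑ i, w i * f (p i) = ∑ κ ∈ multiIndices α s, ∑ i, w i *
        ∫ t, tensorKern α κ (p i) t * D κ (anchors α κ t) ∂gaussian s := by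
      rw [Finset.sum_comm]
      refine Finset.sum_congr rfl fun i _ => ?_
      rw [hrep (p i), Finset.mul_sum]
    rw [hint, h2, ← Finset.sum_sub_distrib]
    refine Finset.sum_congr rfl fun κ hκ => ?_
    have h3 : ∀ i ∈ Finset.univ, Integrable (fun t => w i * (tensorKern α κ (p i) t *
        D κ (anchors α κ t))) (gaussian s) := fun i _ =>
      Integrable.const_mul ((memLp_tensorKern α κ (p i)).integrable_mul (hG κ hκ)) (w i)
    simp only [sub_mul, Finset.sum_mul, mul_assoc]
    have h4 : Integrable (fun t => (∏ j, meanKern α (κ j) (t j)) * D κ (anchors α κ t))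
      (gaussian s) := (memLp_prod_meanKern hα (mem_multiIndices.1 hκ)).integrable_mul (hG κ hκ)
    rw [integral_sub h4 (integrable_finsetSum _ h3), integral_finsetSum _ h3]
    simp only [integral_const_mul]
  rw [herr]
  refine sq_sum_integral_mul_le _ (c := fun κ => ∏ j : Fin s, weight (γ j) (κ j))
    (fun κ => Finset.prod_pos fun j _ => weight_pos (hγ j) _)
    (fun κ hκ => memLp_error hα w p (mem_multiIndices.1 hκ)) hG ?_
  rw [normSq_eq_ofReal hγ hfin] at hN
  simpa using hN

theorem worstCaseError_le (hα : 1 < α) {γ : ℕ → ℝ} (hγ : ∀ j, 0 < γ j) {n : ℕ} (w : Fin n → ℝ)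
    (p : Fin n → Fin s → ℝ) :
    worstCaseError α γ s w p ≤ ENNReal.ofReal (√(errorSq α γ s w p)) :=
  iSup₂_le fun _ hf => ENNReal.ofReal_le_ofReal (Real.abs_le_sqrt (sq_error_le hα hγ hf w p))

theorem sum_prod_multiIndices (F : Fin s → ℕ → ℝ) :
    ∑ κ ∈ multiIndices α s, ∏ j, F j (κ j) = ∏ j, ∑ k ∈ Finset.range (α + 1), F j k :=
  (Finset.prod_univ_sum _ _).symm

theorem minError_zero_le (hα : 1 < α) {γ : ℕ → ℝ} (hγ : ∀ j, 0 < γ j) (s : ℕ) :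
    minError α γ s 0 ≤ ENNReal.ofReal (√(∏ j : Fin s, ∑ k ∈ Finset.range (α + 1),
      weight (γ j) k * ∫ t, meanKern α k t ^ 2 ∂stdGaussian)) := by
  refine (iInf₂_le Fin.elim0 Fin.elim0).trans ((worstCaseError_le hα hγ _ _).trans (le_of_eq ?_))
  congr 2
  rw [errorSq, ← sum_prod_multiIndices]
  refine Finset.sum_congr rfl fun κ _ => ?_
  rw [Finset.prod_mul_distrib]
  congr 1
  simp only [Finset.univ_eq_empty, Finset.sum_empty, sub_zero, ← Finset.prod_pow, gaussian]
  exact integral_fintype_prod_eq_prod (fun j t => meanKern α (κ j) t ^ 2)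

/-- With all weights `1 / n`, the error kernel is `-1 / n` times a sum of `n` deviations from the
mean. Suitable points make the squared norm of that sum at most `n` times the second moment, which
factorizes over the coordinates. -/
theorem minError_le (hα : 1 < α) {γ : ℕ → ℝ} (hγ : ∀ j, 0 < γ j) (s : ℕ) {n : ℕ} (hn : 0 < n) :
    minError α γ s n ≤ ENNReal.ofReal (√((∏ j : Fin s, ∑ k ∈ Finset.range (α + 1),
      weight (γ j) k * ∫ x, ∫ t, kern α k x t ^ 2 ∂stdGaussian ∂stdGaussian) / n)) := by
  have hc : ∀ κ : Fin s → ℕ, 0 ≤ ∏ j : Fin s, weight (γ j) (κ j) := fun κ =>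
    Finset.prod_nonneg fun j _ => (weight_pos (hγ j) _).le
  obtain ⟨p, hp⟩ := exists_points_sum_lintegral_le (μ := gaussian s) (ν := gaussian s)
    (multiIndices α s) (fun κ => ENNReal.ofReal (∏ j : Fin s, weight (γ j) (κ j)))
    (fun κ => tensorKern α κ) (fun κ => measurable_tensorKern α κ) n
  refine (iInf₂_le (fun _ => (n : ℝ)⁻¹) p).trans ((worstCaseError_le hα hγ _ _).trans ?_)
  refine ENNReal.ofReal_le_ofReal (Real.sqrt_le_sqrt ?_)
  have hn' : (0 : ℝ) < n := by exact_mod_cast hn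
  have hS : ∀ κ : Fin s → ℕ, ∀ t, ∏ j, meanKern α (κ j) (t j) -
      ∑ i, (n : ℝ)⁻¹ * tensorKern α κ (p i) t =
      -(n : ℝ)⁻¹ * ∑ i, (tensorKern α κ (p i) t - ∫ x, tensorKern α κ x t ∂gaussian s) := by
    intro κ t
    rw [integral_tensorKern, Finset.sum_sub_distrib, ← Finset.mul_sum]
    simp only [Finset.sum_const, Finset.card_univ, Fintype.card_fin, nsmul_eq_mul]
    field_simp
    ring
  set P := ∏ j : Fin s, ∑ k ∈ Finset.range (α + 1),
      weight (γ j) k * ∫ x, ∫ t, kern α k x t ^ 2 ∂stdGaussian ∂stdGaussian with hP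
  have hP0 : 0 ≤ P := Finset.prod_nonneg fun j _ => Finset.sum_nonneg fun k _ =>
    mul_nonneg (weight_pos (hγ j) k).le
      (integral_nonneg fun x => integral_nonneg fun t => sq_nonneg _)
  have hright : ∑ κ ∈ multiIndices α s, ENNReal.ofReal (∏ j : Fin s, weight (γ j) (κ j)) *
      ∫⁻ t, ∫⁻ x, ENNReal.ofReal (tensorKern α κ x t ^ 2) ∂gaussian s ∂gaussian s =
      ENNReal.ofReal P := by
    rw [hP, ← sum_prod_multiIndices, ENNReal.ofReal_sum_of_nonneg]
    · refine Finset.sum_congr rfl fun κ hκ => ?_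
      have hi := integrable_tensorKern_sq hα (mem_multiIndices.1 hκ)
      rw [Finset.prod_mul_distrib, ENNReal.ofReal_mul (hc κ), ← integral_tensorKern_sq,
        ← integral_prod _ hi, ofReal_integral_eq_lintegral_ofReal hi
          (ae_of_all _ fun x => sq_nonneg _), lintegral_prod_symm]
      exact (((measurable_tensorKern α κ).pow_const 2).ennreal_ofReal).aemeasurable
    · intro κ _
      exact Finset.prod_nonneg fun j _ => mul_nonneg (weight_pos (hγ j) _).le
        (integral_nonneg fun x => integral_nonneg fun t => sq_nonneg _)
  have hdev : ∀ κ ∈ multiIndices α s, Integrable (fun t => (∑ i, (tensorKern α κ (p i) t -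
      ∫ x, tensorKern α κ x t ∂gaussian s)) ^ 2) (gaussian s) := by
    intro κ hκ
    simp only [integral_tensorKern]
    exact (memLp_finsetSum _ fun i _ => (memLp_tensorKern α κ (p i)).sub
      (memLp_prod_meanKern hα (mem_multiIndices.1 hκ))).integrable_sq
  have hleft : ∑ κ ∈ multiIndices α s, ENNReal.ofReal (∏ j : Fin s, weight (γ j) (κ j)) *
      ∫⁻ t, ENNReal.ofReal ((∑ i, (tensorKern α κ (p i) t -
        ∫ x, tensorKern α κ x t ∂gaussian s)) ^ 2) ∂gaussian s =
      ENNReal.ofReal (n ^ 2 * errorSq α γ s (fun _ => (n : ℝ)⁻¹) p) := by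
    rw [errorSq, Finset.mul_sum, ENNReal.ofReal_sum_of_nonneg]
    · refine Finset.sum_congr rfl fun κ hκ => ?_
      simp only [hS, mul_pow, integral_const_mul]
      rw [← ofReal_integral_eq_lintegral_ofReal (hdev κ hκ) (ae_of_all _ fun x => sq_nonneg _),
        ← ENNReal.ofReal_mul (hc κ)]
      congr 1
      field_simp
    · intro κ _
      exact mul_nonneg (sq_nonneg _) (mul_nonneg (hc κ) (integral_nonneg fun t => sq_nonneg _))
  rw [hright, hleft, ← ENNReal.ofReal_natCast n, ← ENNReal.ofReal_mul hn'.le,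
    ENNReal.ofReal_le_ofReal_iff (mul_nonneg hn'.le hP0)] at hp
  rw [le_div_iff₀ hn']
  nlinarith

end

/-! ### Lower bound: decomposing the representer and building fooling functions -/

section

/-- Iterated primitives of `G`, with prescribed values at `0`. -/
def iteratedPrimitive (α : ℕ) (d : ℕ → ℝ) (G : ℝ → ℝ) : ℕ → ℝ → ℝ
  | 0 => G
  | m + 1 => fun x => d (α - (m + 1)) + ∫ t in (0 : ℝ)..x, iteratedPrimitive α d G m t

/-- The function with derivatives `d k` of order `k < α` at `0` and derivative `G` of order `α`,
together with its derivatives. -/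
def chainOf (α : ℕ) (d : ℕ → ℝ) (G : ℝ → ℝ) (k : ℕ) : ℝ → ℝ := iteratedPrimitive α d G (α - k)

theorem chainOf_self (α : ℕ) (d : ℕ → ℝ) (G : ℝ → ℝ) : chainOf α d G α = G := by
  simp [chainOf, iteratedPrimitive]

theorem chainOf_of_lt {α k : ℕ} (hk : k < α) (d : ℕ → ℝ) (G : ℝ → ℝ) (x : ℝ) :
    chainOf α d G k x = d k + ∫ t in (0 : ℝ)..x, chainOf α d G (k + 1) t := by
  have h1 : α - k = (α - (k + 1)) + 1 := by omega
  have h2 : α - (α - (k + 1) + 1) = k := by omega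
  rw [chainOf, h1, iteratedPrimitive, h2]
  rfl

/-- The reciprocal of the density is continuous, hence bounded on compact intervals. -/
theorem intervalIntegrable_of_gaussian {G : ℝ → ℝ} (hG : Integrable G stdGaussian) (a b : ℝ) :
    IntervalIntegrable G volume a b := by
  rw [stdGaussian, gaussianReal_of_var_ne_zero 0 one_ne_zero,
    integrable_withDensity_iff_integrable_smul' (measurable_gaussianPDF 0 1)
      (ae_of_all _ fun _ => ENNReal.ofReal_lt_top)] at hG
  have hφ : ∀ t, gaussianPDFReal 0 1 t ≠ 0 := fun t =>
    (gaussianPDFReal_pos 0 1 t one_ne_zero).ne'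
  have hc : Continuous fun t => (gaussianPDFReal 0 1 t)⁻¹ := by
    refine Continuous.inv₀ ?_ hφ
    unfold gaussianPDFReal
    fun_prop
  refine (hG.intervalIntegrable (a := a) (b := b)).continuousOn_mul hc.continuousOn |>.congr ?_
  intro t _
  have := hφ t
  simp only [gaussianPDF, ENNReal.toReal_ofReal (gaussianPDFReal_nonneg 0 1 t), smul_eq_mul]
  field_simp

theorem isDerivChain_chainOf (α : ℕ) (d : ℕ → ℝ) {G : ℝ → ℝ} (hm : Measurable G)
    (hG : Integrable G stdGaussian) : IsDerivChain α (chainOf α d G) := by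
  have hint : ∀ m a b, IntervalIntegrable (iteratedPrimitive α d G m) volume a b := by
    intro m
    induction m with
    | zero => exact fun a b => intervalIntegrable_of_gaussian hG a b
    | succ m ih =>
      intro a b
      exact (continuous_const.add
        (intervalIntegral.continuous_primitive ih 0)).intervalIntegrable a b
  refine ⟨fun k hk => ?_, fun k _ a b => hint _ a b, fun k hk a b => ?_⟩
  · rcases hk.eq_or_lt with rfl | hk
    · rw [chainOf_self]; exact hm
    · have : chainOf α d G k = fun x => d k + ∫ t in (0 : ℝ)..x, chainOf α d G (k + 1) t := by
        ext x; exact chainOf_of_lt hk d G x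
      rw [this]
      exact (continuous_const.add
        (intervalIntegral.continuous_primitive (fun a b => hint _ a b) 0)).measurable
  · rw [chainOf_of_lt hk, chainOf_of_lt hk, add_sub_add_left_eq_sub]
    exact intervalIntegral.integral_interval_sub_left (hint _ _ _) (hint _ _ _)

theorem chainOf_zero {α k : ℕ} (hk : k < α) (d : ℕ → ℝ) (G : ℝ → ℝ) :
    chainOf α d G k 0 = d k := by
  simp [chainOf_of_lt hk]

theorem IsDerivChain.integral_eq {α : ℕ} (hα : 1 < α) {q : ℕ → ℝ → ℝ} (hq : IsDerivChain α q)
    (h : ∀ k ≤ α, MemLp (fun t => q k (anchor α k t)) 2 stdGaussian) :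
    Integrable (q 0) stdGaussian ∧ ∫ x, q 0 x ∂stdGaussian = ∑ k ∈ Finset.range (α + 1),
      ∫ t, meanKern α k t * q k (anchor α k t) ∂stdGaussian := by
  have hprod : ∀ k ∈ Finset.range (α + 1), Integrable (fun p : ℝ × ℝ =>
      kern α k p.1 p.2 * q k (anchor α k p.2)) (stdGaussian.prod stdGaussian) := by
    intro k hk
    have hk : k ≤ α := Nat.lt_succ_iff.1 (Finset.mem_range.1 hk)
    exact MemLp.integrable_mul (p := 2) (q := 2) ((memLp_two_iff_integrable_sq
      (measurable_kern α k).aestronglyMeasurable).2 (integrable_kern_sq hα hk))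
      ((h k hk).comp_snd stdGaussian)
  have hrep : q 0 = fun x => ∑ k ∈ Finset.range (α + 1),
      ∫ t, kern α k x t * q k (anchor α k t) ∂stdGaussian := by
    ext x; exact hq.eq_sum_integral (zero_lt_one.trans hα) x
  rw [hrep]
  refine ⟨integrable_finsetSum _ fun k hk => (hprod k hk).integral_prod_left, ?_⟩
  rw [integral_finsetSum _ fun k hk => (hprod k hk).integral_prod_left]
  refine Finset.sum_congr rfl fun k hk => ?_
  rw [integral_integral_swap (hprod k hk)]
  simp only [integral_mul_const, meanKern]

/-- The label of a derivative of order `k` at `t`: derivatives of order `k < α` are anchored,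
derivatives of order `α` are distinguished by the sign of `t`. -/
def label (α k : ℕ) (t : ℝ) : Option Bool := if k < α then none else some (decide (0 < t))

/-- The anchored derivatives of the component with label `l` of the representer of the Gaussian
integral in the space of functions of one variable with weight `g`. -/
def coeff (α : ℕ) (g : ℝ) (l : Option Bool) (k : ℕ) (t : ℝ) : ℝ :=
  if label α k t = l then weight g k * meanKern α k t else 0

/-- The component with label `l` of the representer of the Gaussian integral, together with its
derivatives. -/
def component (α : ℕ) (g : ℝ) (l : Option Bool) : ℕ → ℝ → ℝ :=
  chainOf α (fun k => coeff α g l k 0) (coeff α g l α)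

/-- The squared norm of `component α g l`. -/
def componentSq (α : ℕ) (g : ℝ) (l : Option Bool) : ℝ :=
  ∑ k ∈ Finset.range (α + 1), weight g k *
    ∫ t, (if label α k t = l then meanKern α k t ^ 2 else 0) ∂stdGaussian

theorem measurableSet_label (α k : ℕ) (l : Option Bool) : MeasurableSet {t | label α k t = l} := by
  unfold label
  split_ifs
  · exact MeasurableSet.const _
  · rcases l with _ | b
    · simp
    · cases b
      · have h : {t : ℝ | some (decide (0 < t)) = some false} = Set.Iic 0 := by ext t; simp
        exact h ▸ measurableSet_Iic
      · have h : {t : ℝ | some (decide (0 < t)) = some true} = Set.Ioi 0 := by ext t; simp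
        exact h ▸ measurableSet_Ioi

variable {α s : ℕ}

theorem measurable_coeff (α : ℕ) (g : ℝ) (l : Option Bool) (k : ℕ) :
    Measurable (coeff α g l k) :=
  Measurable.ite (measurableSet_label α k l) ((measurable_meanKern α k).const_mul _)
    measurable_const

theorem memLp_coeff (hα : 1 < α) (g : ℝ) (l : Option Bool) {k : ℕ} (hk : k ≤ α) :
    MemLp (coeff α g l k) 2 stdGaussian := by
  have := ((memLp_meanKern hα hk).const_mul (weight g k)).indicator (measurableSet_label α k l)
  refine this.congr_norm (measurable_coeff α g l k).aestronglyMeasurable (ae_of_all _ fun t => ?_)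
  simp [Set.indicator, coeff]

theorem isDerivChain_component (hα : 1 < α) (g : ℝ) (l : Option Bool) :
    IsDerivChain α (component α g l) :=
  isDerivChain_chainOf α _ (measurable_coeff α g l α)
    ((memLp_coeff hα g l le_rfl).integrable one_le_two)

/-- For `k < α` both the label and the mean kernel are independent of `t`, so the value prescribed
at `0` serves for every `t`. -/
theorem component_anchor {k : ℕ} (hk : k ≤ α) (g : ℝ) (l : Option Bool) (t : ℝ) :
    component α g l k (anchor α k t) = coeff α g l k t := by
  rcases hk.eq_or_lt with rfl | hk
  · simp [component, chainOf_self, anchor]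
  · simp [component, anchor, hk, chainOf_zero hk, coeff, label, meanKern, kern]

theorem component_eq_sum (hα : 1 < α) (g : ℝ) (l : Option Bool) (x : ℝ) :
    component α g l 0 x = ∑ k ∈ Finset.range (α + 1),
      ∫ t, kern α k x t * coeff α g l k t ∂stdGaussian := by
  rw [(isDerivChain_component hα g l).eq_sum_integral (zero_lt_one.trans hα) x]
  refine Finset.sum_congr rfl fun k hk => ?_
  simp only [component_anchor (Nat.lt_succ_iff.1 (Finset.mem_range.1 hk))]

/-- In the Taylor formula at `x`, the remainder kernel only sees `t` on the same side of `0` as `x`,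
where the label of `t` is that of `x`. A component carrying the other sign contributes nothing
there, and it has no polynomial part. -/
theorem component_eq_zero (hα : 1 < α) (g : ℝ) {l : Option Bool} {x : ℝ} (h1 : l ≠ none)
    (h2 : l ≠ some (decide (0 < x))) : component α g l 0 x = 0 := by
  rw [component_eq_sum hα]
  refine Finset.sum_eq_zero fun k _ => integral_eq_zero_of_ae (ae_of_all _ fun t => ?_)
  by_cases hk : k < α
  · simp [coeff, label, hk, h1.symm]
  · simp only [kern, coeff, label, hk, if_false, Pi.zero_apply]
    by_cases h3 : 0 < t ∧ t ≤ x
    · rw [if_neg (c := some _ = l), mul_zero]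
      rintro rfl
      have : 0 < x := h3.1.trans_le h3.2
      simp [h3.1, this] at h2
    · by_cases h4 : x < t ∧ t ≤ 0
      · rw [if_neg (c := some _ = l), mul_zero]
        rintro rfl
        have : ¬ 0 < x := by linarith
        simp [not_lt.2 h4.2, this] at h2
      · simp [h3, h4]

/-- Integration is the inner product with the full representer, and the anchored derivatives of a
component are those of the representer cut off to one label. The integral is therefore the squared
norm of the component. -/
theorem integral_component (hα : 1 < α) (g : ℝ) (l : Option Bool) :
    Integrable (component α g l 0) stdGaussian ∧
      ∫ x, component α g l 0 x ∂stdGaussian = componentSq α g l := by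
  have h := (isDerivChain_component hα g l).integral_eq hα fun k hk => by
    simp only [component_anchor hk]; exact memLp_coeff hα g l hk
  refine ⟨h.1, h.2.trans (Finset.sum_congr rfl fun k hk => ?_)⟩
  simp only [component_anchor (Nat.lt_succ_iff.1 (Finset.mem_range.1 hk))]
  rw [← integral_const_mul]
  congr 1 with t
  simp only [coeff]
  split_ifs
  · ring
  · simp

theorem isDerivSystem_sum_prod {Λ : Type*} (S : Finset Λ) (c : ℝ) {q : Λ → Fin s → ℕ → ℝ → ℝ}
    (hq : ∀ l j, IsDerivChain α (q l j)) :
    IsDerivSystem α (fun x => c * ∑ l ∈ S, ∏ j, q l j 0 (x j))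
      (fun τ x => c * ∑ l ∈ S, ∏ j, q l j (τ j) (x j)) := by
  have h1 : ∀ (τ : Fin s → ℕ) l j x t, ∏ i, q l i (τ i) (Function.update x j t i) =
      (∏ i ∈ Finset.univ.erase j, q l i (τ i) (x i)) * q l j (τ j) t := by
    intro τ l j x t
    rw [← Finset.prod_erase_mul _ _ (Finset.mem_univ j), Function.update_self]
    congr 1
    refine Finset.prod_congr rfl fun i hi => ?_
    rw [Function.update_of_ne (Finset.ne_of_mem_erase hi)]
  have h2 : ∀ (τ : Fin s → ℕ) l j x t,
      ∏ i, q l i ((τ + Pi.single j 1 : Fin s → ℕ) i) (Function.update x j t i) =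
      (∏ i ∈ Finset.univ.erase j, q l i (τ i) (x i)) * q l j (τ j + 1) t := by
    intro τ l j x t
    rw [h1]
    congr 1
    · refine Finset.prod_congr rfl fun i hi => ?_
      simp [Finset.ne_of_mem_erase hi]
    · simp
  have hi : ∀ (τ : Fin s → ℕ) l j (x : Fin s → ℝ) (a b : ℝ), τ j < α → IntervalIntegrable
      (fun t => (∏ i ∈ Finset.univ.erase j, q l i (τ i) (x i)) * q l j (τ j + 1) t) volume a b :=
    fun τ l j x a b hj => ((hq l j).intervalIntegrable _ hj a b).const_mul _
  refine ⟨rfl, fun τ hτ => ?_, fun τ hτ j hj x a b => ?_, fun τ hτ j hj x a b => ?_⟩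
  · refine Measurable.const_mul (Finset.measurable_sum _ fun l _ =>
      Finset.measurable_prod _ fun j _ => ?_) c
    exact ((hq l j).measurable _ (hτ j)).comp (measurable_pi_apply j)
  · simp only [h2]
    refine IntervalIntegrable.const_mul ?_ c
    have h3 := IntervalIntegrable.sum S (μ := volume) (a := a) (b := b) (f := fun l t =>
      (∏ i ∈ Finset.univ.erase j, q l i (τ i) (x i)) * q l j (τ j + 1) t)
      fun l _ => hi τ l j x a b hj
    simpa only [Finset.sum_fn] using h3
  · simp only [h2, h1]
    rw [intervalIntegral.integral_const_mul,
      intervalIntegral.integral_finsetSum fun l _ => hi τ l j x a b hj, ← mul_sub,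
      ← Finset.sum_sub_distrib]
    congr 1
    refine Finset.sum_congr rfl fun l _ => ?_
    rw [intervalIntegral.integral_const_mul, ← (hq l j).sub_eq_integral _ hj, mul_sub]

/-- Orthogonality of the tensor pieces: given `κ` and `t`, only the piece labelled by the actual
labels of the coordinates can be nonzero, so all cross terms vanish pointwise. -/
theorem coeff_prod_sq (γ : ℕ → ℝ) (S : Finset (Fin s → Option Bool)) (κ : Fin s → ℕ)
    (t : Fin s → ℝ) :
    (∑ l ∈ S, ∏ j : Fin s, coeff α (γ j) (l j) (κ j) (t j)) ^ 2 = ∑ l ∈ S, ∏ j : Fin s,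
      (weight (γ j) (κ j) ^ 2 *
        if label α (κ j) (t j) = l j then meanKern α (κ j) (t j) ^ 2 else 0) := by
  have h1 : ∀ l : Fin s → Option Bool, ∏ j : Fin s, coeff α (γ j) (l j) (κ j) (t j) =
      if (fun j => label α (κ j) (t j)) = l then
        ∏ j : Fin s, weight (γ j) (κ j) * meanKern α (κ j) (t j) else 0 := by
    intro l
    simp only [coeff, Finset.prod_ite_zero, Finset.mem_univ, true_imp_iff, funext_iff]
  have h2 : ∀ l : Fin s → Option Bool, ∏ j : Fin s, (weight (γ j) (κ j) ^ 2 *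
        if label α (κ j) (t j) = l j then meanKern α (κ j) (t j) ^ 2 else 0) =
      if (fun j => label α (κ j) (t j)) = l then
        (∏ j : Fin s, weight (γ j) (κ j) * meanKern α (κ j) (t j)) ^ 2 else 0 := by
    intro l
    simp only [mul_ite, mul_zero, Finset.prod_ite_zero, Finset.mem_univ, true_imp_iff, funext_iff,
      ← Finset.prod_pow, mul_pow]
  simp only [h1, h2, Finset.sum_ite_eq]
  split_ifs <;> simp

theorem integrable_label (hα : 1 < α) (l : Option Bool) {k : ℕ} (hk : k ≤ α) :
    Integrable (fun t => if label α k t = l then meanKern α k t ^ 2 else 0) stdGaussian := by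
  have := (memLp_meanKern hα hk).integrable_sq.indicator (measurableSet_label α k l)
  refine this.congr (ae_of_all _ fun t => ?_)
  simp [Set.indicator]

theorem componentSq_nonneg {g : ℝ} (hg : 0 < g) (l : Option Bool) : 0 ≤ componentSq α g l := by
  refine Finset.sum_nonneg fun k _ => mul_nonneg (weight_pos hg k).le (integral_nonneg fun t => ?_)
  dsimp only [Pi.zero_apply]
  split_ifs <;> positivity

/-- The fooling function is the normalized sum of the pieces in `S`. By the condition on `S`, every
piece has a vanishing factor at every point `p i`, so the algorithm returns `0`. -/
theorem sqrt_le_worstCaseError (hα : 1 < α) {γ : ℕ → ℝ} (hγ : ∀ j, 0 < γ j) {n : ℕ}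
    (w : Fin n → ℝ) (p : Fin n → Fin s → ℝ) (S : Finset (Fin s → Option Bool))
    (hS : ∀ l ∈ S, ∀ i, ∃ j, l j ≠ none ∧ l j ≠ some (decide (0 < p i j))) :
    ENNReal.ofReal (√(∑ l ∈ S, ∏ j : Fin s, componentSq α (γ j) (l j))) ≤
      worstCaseError α γ s w p := by
  set T := ∑ l ∈ S, ∏ j : Fin s, componentSq α (γ j) (l j) with hT
  have hT0 : 0 ≤ T := Finset.sum_nonneg fun l _ => Finset.prod_nonneg fun j _ =>
    componentSq_nonneg (hγ j) _
  rcases hT0.eq_or_lt with h0 | h0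
  · simp [← h0]
  -- The unscaled sum has both squared norm and integral equal to `T`; dividing by `√T` gives norm
  -- one and integral `√T`.
  set c := (√T)⁻¹ with hc
  have hsqrt : 0 < √T := Real.sqrt_pos.2 h0
  have hc2 : c ^ 2 * T = 1 := by
    rw [hc, inv_pow, Real.sq_sqrt hT0]; field_simp
  have hcT : c * T = √T := by
    rw [hc, inv_mul_eq_div, Real.div_sqrt]
  have hD := isDerivSystem_sum_prod S c
    (q := fun (l : Fin s → Option Bool) (j : Fin s) => component α (γ j) (l j))
    fun l j => isDerivChain_component hα (γ j) (l j)
  have hsq : ∀ κ : Fin s → ℕ, (∀ j, κ j ≤ α) → ∀ t : Fin s → ℝ,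
      (c * ∑ l ∈ S, ∏ j : Fin s, component α (γ j) (l j) (κ j) (anchors α κ t j)) ^ 2 =
      c ^ 2 * ∑ l ∈ S, ∏ j : Fin s, (weight (γ j) (κ j) ^ 2 *
        if label α (κ j) (t j) = l j then meanKern α (κ j) (t j) ^ 2 else 0) := by
    intro κ hκ t
    rw [mul_pow, ← coeff_prod_sq]
    simp only [anchors, component_anchor (hκ _)]
  have hi : ∀ κ : Fin s → ℕ, (∀ j, κ j ≤ α) → ∀ l ∈ S, Integrable (fun t : Fin s → ℝ =>
      ∏ j : Fin s, (weight (γ j) (κ j) ^ 2 *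
        if label α (κ j) (t j) = l j then meanKern α (κ j) (t j) ^ 2 else 0)) (gaussian s) := by
    intro κ hκ l _
    exact Integrable.fintype_prod (f := fun (j : Fin s) t => weight (γ j) (κ j) ^ 2 *
      if label α (κ j) t = l j then meanKern α (κ j) t ^ 2 else 0)
      fun j => (integrable_label hα (l j) (hκ j)).const_mul _
  have hmem : (fun x => c * ∑ l ∈ S, ∏ j : Fin s, component α (γ j) (l j) 0 (x j)) ∈
      unitBall α γ s := by
    refine ⟨_, hD, ?_⟩
    rw [normSq_eq_ofReal hγ fun κ hκ => by
      simp only [hsq κ hκ]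
      exact (integrable_finsetSum _ (hi κ hκ)).const_mul _]
    refine ENNReal.ofReal_le_one.2 (le_of_eq ?_)
    rw [← hc2, hT, Finset.mul_sum]
    simp only [componentSq, ← sum_prod_multiIndices]
    rw [← Finset.mul_sum, Finset.sum_comm, Finset.mul_sum]
    refine Finset.sum_congr rfl fun κ hκ => ?_
    have hκ := mem_multiIndices.1 hκ
    simp only [hsq κ hκ]
    rw [integral_const_mul, integral_finsetSum _ (hi κ hκ), mul_left_comm, Finset.mul_sum]
    congr 1
    refine Finset.sum_congr rfl fun l _ => ?_
    rw [gaussian, integral_fintype_prod_eq_prod (fun (j : Fin s) t => weight (γ j) (κ j) ^ 2 *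
      if label α (κ j) t = l j then meanKern α (κ j) t ^ 2 else 0), ← Finset.prod_inv_distrib,
      ← Finset.prod_mul_distrib]
    refine Finset.prod_congr rfl fun j _ => ?_
    have := (weight_pos (hγ j) (κ j)).ne'
    rw [integral_const_mul]
    field_simp
  have hint : ∫ x, c * ∑ l ∈ S, ∏ j : Fin s, component α (γ j) (l j) 0 (x j) ∂gaussian s = √T := by
    rw [integral_const_mul, integral_finsetSum, ← hcT, hT]
    · congr 1
      refine Finset.sum_congr rfl fun l _ => ?_
      rw [gaussian, integral_fintype_prod_eq_prod (fun (j : Fin s) => component α (γ j) (l j) 0)]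
      exact Finset.prod_congr rfl fun j _ => (integral_component hα (γ j) (l j)).2
    · intro l _
      exact Integrable.fintype_prod (f := fun (j : Fin s) => component α (γ j) (l j) 0)
        fun j => (integral_component hα (γ j) (l j)).1
  have hvanish : ∀ i, c * ∑ l ∈ S, ∏ j : Fin s, component α (γ j) (l j) 0 (p i j) = 0 := by
    intro i
    rw [Finset.sum_eq_zero, mul_zero]
    intro l hl
    obtain ⟨j, h1, h2⟩ := hS l hl i
    exact Finset.prod_eq_zero (Finset.mem_univ j) (component_eq_zero hα (γ j) h1 h2)
  refine le_trans (le_of_eq ?_) (le_iSup₂ (f := fun (f : (Fin s → ℝ) → ℝ) (_ : f ∈ unitBall α γ s) =>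
    ENNReal.ofReal |∫ x, f x ∂gaussian s - ∑ i, w i * f (p i)|) _ hmem)
  simp only [hvanish, hint, mul_zero, Finset.sum_const_zero, sub_zero, abs_of_pos hsqrt]

end

/-! ### Constants and two-sided bounds for the information complexity -/

section

variable {α s : ℕ}

/-- For fixed `t` the kernel has constant sign in `x`, namely `+` if `t > 0` and `(-1) ^ α` if `t ≤
0`. It is nonzero on the open half-line beyond `t`, which has positive Gaussian measure. -/
theorem meanKern_ne_zero (hα : 0 < α) {t : ℝ} (h : Integrable (fun x => kern α α x t) stdGaussian) :
    meanKern α α t ≠ 0 := by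
  have hφ := gaussianPDFReal_pos 0 1 t one_ne_zero
  have hopen : stdGaussian.IsOpenPosMeasure :=
    (gaussianReal_absolutelyContinuous' 0 one_ne_zero).isOpenPosMeasure
  have key : ∀ (c : ℝ) (U : Set ℝ), IsOpen U → U.Nonempty → (∀ x, 0 ≤ c * kern α α x t) →
      (∀ x ∈ U, c * kern α α x t ≠ 0) → meanKern α α t ≠ 0 := by
    intro c U hU hne h0 hpos hzero
    have h1 : 0 < ∫ x, c * kern α α x t ∂stdGaussian := by
      rw [integral_pos_iff_support_of_nonneg h0 (h.const_mul c)]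
      exact (hU.measure_pos _ hne).trans_le (measure_mono hpos)
    rw [integral_const_mul] at h1
    change 0 < c * meanKern α α t at h1
    rw [hzero, mul_zero] at h1
    exact lt_irrefl _ h1
  have hf : (0 : ℝ) < (α - 1).factorial := by positivity
  by_cases ht : 0 < t
  · refine key 1 (Set.Ioi t) isOpen_Ioi Set.nonempty_Ioi (fun x => ?_) (fun x hx => ?_)
    · simp only [kern, lt_irrefl, if_false, one_mul]
      split_ifs with h1 h2
      · have : 0 ≤ x - t := by linarith
        positivity
      · linarith
      · simp
    · have hx : t < x := hx
      have : 0 < x - t := by linarith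
      simp only [kern, lt_irrefl, if_false, one_mul]
      rw [if_pos ⟨ht, hx.le⟩]
      positivity
  · have hsign : ∀ x, (-1 : ℝ) ^ α * (-1 * ((x - t) ^ (α - 1) / (α - 1).factorial)
        / gaussianPDFReal 0 1 t) = (-1) ^ α * (-1) * (-1) ^ (α - 1) *
          ((t - x) ^ (α - 1) / (α - 1).factorial / gaussianPDFReal 0 1 t) := by
      intro x
      rw [← neg_sub t x, neg_pow (t - x)]
      ring
    have hone : (-1 : ℝ) ^ α * (-1) * (-1) ^ (α - 1) = 1 := by
      obtain ⟨m, rfl⟩ : ∃ m, α = m + 1 := ⟨α - 1, by omega⟩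
      rw [Nat.add_sub_cancel, ← pow_succ, ← pow_add]
      exact Even.neg_one_pow ⟨m + 1, by ring⟩
    refine key ((-1) ^ α) (Set.Iio t) isOpen_Iio Set.nonempty_Iio (fun x => ?_) (fun x hx => ?_)
    · simp only [kern, lt_irrefl, if_false]
      split_ifs with h1 h2
      · linarith
      · rw [hsign, hone, one_mul]
        have : 0 ≤ t - x := by linarith
        positivity
      · simp
    · have hx : x < t := hx
      have : 0 < t - x := by linarith
      simp only [kern, lt_irrefl, if_false]
      rw [if_neg (by intro h; linarith), if_pos ⟨hx, not_lt.1 ht⟩, hsign, hone, one_mul]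
      positivity

/-- The squared norm of the part of the representer of the Gaussian integral living on one of the
half-lines. -/
def halfSq (α : ℕ) (b : Bool) : ℝ :=
  ∫ t, (if decide (0 < t) = b then meanKern α α t ^ 2 else 0) ∂stdGaussian

theorem halfSq_pos (hα : 1 < α) (b : Bool) : 0 < halfSq α b := by
  have hopen : stdGaussian.IsOpenPosMeasure :=
    (gaussianReal_absolutelyContinuous' 0 one_ne_zero).isOpenPosMeasure
  have hi : Integrable (fun t : ℝ => if decide (0 < t) = b then meanKern α α t ^ 2 else 0)
      stdGaussian := by
    simpa [label] using integrable_label hα (some b) le_rfl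
  have hne : ∀ᵐ t ∂stdGaussian, meanKern α α t ≠ 0 := by
    have h1 := (integrable_kern_sq hα (le_refl α)).prod_left_ae
    filter_upwards [h1] with t ht
    refine meanKern_ne_zero (zero_lt_one.trans hα) (MemLp.integrable one_le_two ?_)
    exact (memLp_two_iff_integrable_sq
      ((measurable_kern α α).comp measurable_prodMk_right).aestronglyMeasurable).2 ht
  rw [halfSq, integral_pos_iff_support_of_nonneg (fun t => by positivity) hi]
  have hU : ∃ U : Set ℝ, IsOpen U ∧ U.Nonempty ∧ ∀ t ∈ U, decide (0 < t) = b := by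
    cases b
    · exact ⟨Set.Iio 0, isOpen_Iio, Set.nonempty_Iio, fun t ht => by
        simpa using (Set.mem_Iio.1 ht).le⟩
    · exact ⟨Set.Ioi 0, isOpen_Ioi, Set.nonempty_Ioi, fun t ht => by simpa using ht⟩
  obtain ⟨U, hU, hUne, hUb⟩ := hU
  refine (hU.measure_pos stdGaussian hUne).trans_le (measure_mono_ae ?_)
  filter_upwards [hne] with t ht htU
  change (if decide (0 < t) = b then meanKern α α t ^ 2 else 0) ≠ 0
  rw [if_pos (hUb t htU)]
  exact pow_ne_zero 2 ht

theorem componentSq_some (hα : 1 < α) (g : ℝ) (b : Bool) :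
    componentSq α g (some b) = g * halfSq α b := by
  rw [componentSq, Finset.sum_range_succ, Finset.sum_eq_zero, zero_add]
  · simp [label, weight, halfSq, show α ≠ 0 by omega]
  · intro k hk
    simp [label, Finset.mem_range.1 hk]

/-- The squared initial error of the problem in one variable of weight `g`. -/
def initialSq (α : ℕ) (g : ℝ) : ℝ :=
  ∑ k ∈ Finset.range (α + 1), weight g k * ∫ t, meanKern α k t ^ 2 ∂stdGaussian

theorem sum_componentSq (hα : 1 < α) (g : ℝ) : ∑ l, componentSq α g l = initialSq α g := by
  simp only [componentSq, initialSq]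
  rw [Finset.sum_comm]
  refine Finset.sum_congr rfl fun k hk => ?_
  rw [← Finset.mul_sum, ← integral_finsetSum _ fun l _ =>
    integrable_label hα l (Nat.lt_succ_iff.1 (Finset.mem_range.1 hk))]
  simp

theorem sum_weight_mul (α : ℕ) (g : ℝ) {a : ℕ → ℝ} (ha : a 0 = 1) :
    ∑ k ∈ Finset.range (α + 1), weight g k * a k = 1 + g * ∑ k ∈ Finset.range α, a (k + 1) := by
  rw [Finset.sum_range_succ', add_comm, Finset.mul_sum]
  simp [weight, ha]

/-- The derivative of `initialSq α g` with respect to the weight. -/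
def initialSlope (α : ℕ) : ℝ :=
  ∑ k ∈ Finset.range α, ∫ t, meanKern α (k + 1) t ^ 2 ∂stdGaussian

theorem initialSlope_nonneg (α : ℕ) : 0 ≤ initialSlope α :=
  Finset.sum_nonneg fun _ _ => integral_nonneg fun _ => sq_nonneg _

theorem initialSq_eq (hα : 1 < α) (g : ℝ) : initialSq α g = 1 + g * initialSlope α := by
  refine sum_weight_mul α g (a := fun k => ∫ t, meanKern α k t ^ 2 ∂stdGaussian) ?_
  simp [meanKern, kern, show 0 < α by omega]

theorem one_le_prod_initialSq (hα : 1 < α) {γ : ℕ → ℝ} (hγ : ∀ j, 0 < γ j) (s : ℕ) :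
    1 ≤ ∏ j : Fin s, initialSq α (γ j) := by
  have : ∀ j : Fin s, 1 ≤ initialSq α (γ j) := fun j => by
    rw [initialSq_eq hα]
    have := mul_nonneg (hγ j).le (initialSlope_nonneg α)
    linarith
  calc (1 : ℝ) = ∏ j : Fin s, 1 := by simp
    _ ≤ _ := Finset.prod_le_prod (fun _ _ => zero_le_one) fun j _ => this j

/-- The exponent in the lower bound for the information complexity. -/
def lowerRate (α : ℕ) : ℝ := min (halfSq α true) (halfSq α false) / (1 + initialSlope α)

theorem lowerRate_pos (hα : 1 < α) : 0 < lowerRate α :=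
  div_pos (lt_min (halfSq_pos hα _) (halfSq_pos hα _))
    (by linarith [initialSlope_nonneg α])

/-- The omitted half-line piece has squared norm at least `g * min (halfSq α true) (halfSq α
false)`. Since `g ≤ 1`, `initialSq α g ≤ 1 + initialSlope α`, so this is at least the fraction
`lowerRate α * g` of the total; then `1 - y ≤ exp (-y)`. -/
theorem componentSq_none_add_some_le (hα : 1 < α) {g : ℝ} (hg : 0 < g) (hg1 : g ≤ 1) (b : Bool) :
    componentSq α g none + componentSq α g (some b) ≤
      initialSq α g * Real.exp (-(lowerRate α * g)) := by
  have h1 : componentSq α g none + componentSq α g (some b) ≤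
      initialSq α g - g * min (halfSq α true) (halfSq α false) := by
    have h2 : g * min (halfSq α true) (halfSq α false) ≤ componentSq α g (some !b) := by
      rw [componentSq_some hα]
      cases b
      · exact mul_le_mul_of_nonneg_left (min_le_left _ _) hg.le
      · exact mul_le_mul_of_nonneg_left (min_le_right _ _) hg.le
    have h3 := sum_componentSq hα g
    rw [Fintype.sum_option, Fintype.sum_bool] at h3
    cases b <;> simp only [Bool.not_true, Bool.not_false] at h2 <;> linarith
  have hs := initialSlope_nonneg α
  have hI : 0 < initialSq α g := by
    rw [initialSq_eq hα]; positivity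
  have hI2 : initialSq α g ≤ 1 + initialSlope α := by
    rw [initialSq_eq hα]; nlinarith
  have h4 : lowerRate α * g * initialSq α g ≤ g * min (halfSq α true) (halfSq α false) := by
    have h5 : 0 ≤ lowerRate α * g := (mul_pos (lowerRate_pos hα) hg).le
    calc _ ≤ lowerRate α * g * (1 + initialSlope α) := by gcongr
      _ = _ := by unfold lowerRate; field_simp
  have h6 := Real.add_one_le_exp (-(lowerRate α * g))
  nlinarith

theorem sum_biUnion_le {ι κ : Type*} [DecidableEq κ] (S : Finset ι) (t : ι → Finset κ)
    {f : κ → ℝ} (hf : ∀ l, 0 ≤ f l) : ∑ l ∈ S.biUnion t, f l ≤ ∑ i ∈ S, ∑ l ∈ t i, f l := by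
  classical
  induction S using Finset.induction_on with
  | empty => simp
  | insert i S hi ih =>
    rw [Finset.biUnion_insert, Finset.sum_insert hi]
    have h1 := Finset.sum_union_inter (s₁ := t i) (s₂ := S.biUnion t) (f := f)
    have h2 : 0 ≤ ∑ l ∈ t i ∩ S.biUnion t, f l := Finset.sum_nonneg fun l _ => hf l
    linarith

/-- Union bound over the points. The label tuples that may survive at `p i` form a product of
two-element sets, `none` or the sign of the coordinate, so their total mass factorizes. -/
theorem sum_good_labels_ge (hα : 1 < α) {γ : ℕ → ℝ} (hγ : ∀ j, 0 < γ j) (hγ1 : ∀ j, γ j ≤ 1)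
    {n : ℕ} (p : Fin n → Fin s → ℝ) :
    (∏ j : Fin s, initialSq α (γ j)) *
        (1 - n * Real.exp (-(lowerRate α * ∑ j : Fin s, γ j))) ≤
      ∑ l : Fin s → Option Bool with ∀ i, ∃ j, l j ≠ none ∧ l j ≠ some (decide (0 < p i j)),
        ∏ j : Fin s, componentSq α (γ j) (l j) := by
  have hN : ∀ l : Fin s → Option Bool, 0 ≤ ∏ j : Fin s, componentSq α (γ j) (l j) := fun l =>
    Finset.prod_nonneg fun j _ => componentSq_nonneg (hγ j) _
  have htotal : ∑ l : Fin s → Option Bool, ∏ j : Fin s, componentSq α (γ j) (l j) =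
      ∏ j : Fin s, initialSq α (γ j) := by
    rw [← Fintype.prod_sum]
    exact Finset.prod_congr rfl fun j _ => sum_componentSq hα (γ j)
  have hbad : ∑ l : Fin s → Option Bool with
      ¬ ∀ i, ∃ j, l j ≠ none ∧ l j ≠ some (decide (0 < p i j)),
        ∏ j : Fin s, componentSq α (γ j) (l j) ≤
      n * ((∏ j : Fin s, initialSq α (γ j)) *
        Real.exp (-(lowerRate α * ∑ j : Fin s, γ j))) := by
    calc _ ≤ ∑ l ∈ Finset.univ.biUnion fun i : Fin n => Fintype.piFinset fun j : Fin s =>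
            ({none, some (decide (0 < p i j))} : Finset (Option Bool)),
            ∏ j : Fin s, componentSq α (γ j) (l j) := by
          refine Finset.sum_le_sum_of_subset_of_nonneg (fun l hl => ?_) fun l _ _ => hN l
          have hl := (Finset.mem_filter.1 hl).2
          push Not at hl
          obtain ⟨i, hi⟩ := hl
          refine Finset.mem_biUnion.2 ⟨i, Finset.mem_univ _, Fintype.mem_piFinset.2 fun j => ?_⟩
          by_cases h : l j = none
          · simp [h]
          · simp [hi j h]
      _ ≤ ∑ i : Fin n, ∑ l ∈ Fintype.piFinset fun j : Fin s =>
            ({none, some (decide (0 < p i j))} : Finset (Option Bool)),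
            ∏ j : Fin s, componentSq α (γ j) (l j) := by
          exact sum_biUnion_le _ _ hN
      _ ≤ ∑ i : Fin n, (∏ j : Fin s, initialSq α (γ j)) *
        Real.exp (-(lowerRate α * ∑ j : Fin s, γ j)) := by
          refine Finset.sum_le_sum fun i _ => ?_
          rw [← Finset.prod_univ_sum, Finset.mul_sum, ← Finset.sum_neg_distrib, Real.exp_sum,
            ← Finset.prod_mul_distrib]
          refine Finset.prod_le_prod (fun j _ => Finset.sum_nonneg fun l _ =>
            componentSq_nonneg (hγ j) l) fun j _ => ?_
          rw [Finset.sum_pair (by simp)]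
          exact componentSq_none_add_some_le hα (hγ j) (hγ1 j) _
      _ = _ := by simp
  rw [← htotal, ← Finset.sum_filter_add_sum_filter_not Finset.univ
    (fun l : Fin s → Option Bool => ∀ i, ∃ j, l j ≠ none ∧ l j ≠ some (decide (0 < p i j)))] at *
  rw [mul_sub, mul_one]
  linarith

/-- When `n` is so large that the radicand is negative, the square root is `0` and the bound is
trivial. -/
theorem le_minError (hα : 1 < α) {γ : ℕ → ℝ} (hγ : ∀ j, 0 < γ j) (hγ1 : ∀ j, γ j ≤ 1) (s n : ℕ) :
    ENNReal.ofReal (√((∏ j : Fin s, initialSq α (γ j)) *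
        (1 - n * Real.exp (-(lowerRate α * ∑ j : Fin s, γ j))))) ≤ minError α γ s n := by
  refine le_iInf₂ fun w p => le_trans (ENNReal.ofReal_le_ofReal (Real.sqrt_le_sqrt
    (sum_good_labels_ge hα hγ hγ1 p))) (sqrt_le_worstCaseError hα hγ w p _ fun l hl => ?_)
  exact (Finset.mem_filter.1 hl).2

theorem minError_zero_eq (hα : 1 < α) {γ : ℕ → ℝ} (hγ : ∀ j, 0 < γ j) (hγ1 : ∀ j, γ j ≤ 1)
    (s : ℕ) : minError α γ s 0 = ENNReal.ofReal (√(∏ j : Fin s, initialSq α (γ j))) := by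
  refine le_antisymm (minError_zero_le hα hγ s) ?_
  simpa using le_minError hα hγ hγ1 s 0

/-- Together with `scale_le` this handles both criteria at once: upper bounds on the complexity use
`1 ≤ scale`, lower bounds use that the scale is at most the initial error. -/
theorem one_le_scale (hα : 1 < α) {γ : ℕ → ℝ} (hγ : ∀ j, 0 < γ j) (hγ1 : ∀ j, γ j ≤ 1)
    (c : ErrorCriterion) (s : ℕ) : 1 ≤ c.scale α γ s := by
  cases c
  · exact le_rfl
  · rw [ErrorCriterion.scale, minError_zero_eq hα hγ hγ1]
    exact ENNReal.one_le_ofReal.2 (Real.one_le_sqrt.2 (one_le_prod_initialSq hα hγ s))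

theorem scale_le (hα : 1 < α) {γ : ℕ → ℝ} (hγ : ∀ j, 0 < γ j) (hγ1 : ∀ j, γ j ≤ 1)
    (c : ErrorCriterion) (s : ℕ) :
    c.scale α γ s ≤ ENNReal.ofReal (√(∏ j : Fin s, initialSq α (γ j))) := by
  cases c
  · exact ENNReal.one_le_ofReal.2 (Real.one_le_sqrt.2 (one_le_prod_initialSq hα hγ s))
  · exact (minError_zero_eq hα hγ hγ1 s).le

theorem le_infoComplexity (hα : 1 < α) {γ : ℕ → ℝ} (hγ : ∀ j, 0 < γ j) (hγ1 : ∀ j, γ j ≤ 1)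
    (c : ErrorCriterion) (s : ℕ) {ε : ℝ} (hε : 0 < ε) {n : ℕ}
    (h : minError α γ s n ≤ ENNReal.ofReal ε * c.scale α γ s) :
    (1 - ε ^ 2) * Real.exp (lowerRate α * ∑ j ∈ Finset.range s, γ j) ≤ n := by
  set P := ∏ j : Fin s, initialSq α (γ j) with hP
  have hP1 : 1 ≤ P := one_le_prod_initialSq hα hγ s
  have h1 := ((le_minError hα hγ hγ1 s n).trans h).trans
    (mul_le_mul_right (scale_le hα hγ hγ1 c s) _)
  rw [← ENNReal.ofReal_mul hε.le, ENNReal.ofReal_le_ofReal_iff (by positivity),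
    Real.sqrt_le_left (by positivity), mul_pow, Real.sq_sqrt (by positivity), ← hP,
    mul_comm (ε ^ 2), mul_le_mul_iff_right₀ (by positivity), Real.exp_neg] at h1
  rw [← Fin.sum_univ_eq_sum_range]
  set X := Real.exp (lowerRate α * ∑ j : Fin s, γ j)
  have hX : 0 < X := Real.exp_pos _
  have h2 : 1 - ε ^ 2 ≤ n / X := by rw [div_eq_mul_inv]; linarith
  exact (le_div_iff₀ hX).1 h2

/-- The exponent in the upper bound for the information complexity. -/
def upperRate (α : ℕ) : ℝ :=
  ∑ k ∈ Finset.range α, ∫ x, ∫ t, kern α (k + 1) x t ^ 2 ∂stdGaussian ∂stdGaussian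

theorem upperRate_nonneg (α : ℕ) : 0 ≤ upperRate α :=
  Finset.sum_nonneg fun _ _ => integral_nonneg fun _ => integral_nonneg fun _ => sq_nonneg _

theorem minError_le_exp (hα : 1 < α) {γ : ℕ → ℝ} (hγ : ∀ j, 0 < γ j) (s : ℕ) {n : ℕ}
    (hn : 0 < n) :
    minError α γ s n ≤
      ENNReal.ofReal (√(Real.exp (upperRate α * ∑ j ∈ Finset.range s, γ j) / n)) := by
  refine (minError_le hα hγ s hn).trans (ENNReal.ofReal_le_ofReal (Real.sqrt_le_sqrt ?_))
  gcongr
  rw [Finset.mul_sum, Real.exp_sum, ← Fin.prod_univ_eq_prod_range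
    (fun j => Real.exp (upperRate α * γ j)) s]
  have h : ∀ j : Fin s, ∑ k ∈ Finset.range (α + 1),
      weight (γ j) k * ∫ x, ∫ t, kern α k x t ^ 2 ∂stdGaussian ∂stdGaussian =
      1 + γ j * upperRate α := fun j => by
    refine sum_weight_mul α (γ j)
      (a := fun k => ∫ x, ∫ t, kern α k x t ^ 2 ∂stdGaussian ∂stdGaussian) ?_
    simp [kern, show 0 < α by omega]
  refine Finset.prod_le_prod (fun j _ => ?_) fun j _ => ?_
  · rw [h]
    have := mul_nonneg (hγ j).le (upperRate_nonneg α)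
    linarith
  · rw [h, add_comm, mul_comm]
    exact Real.add_one_le_exp _

/-- Two-sided bounds for the information complexity. -/
theorem exists_infoComplexity_eq (hα : 1 < α) {γ : ℕ → ℝ} (hγ : ∀ j, 0 < γ j)
    (hγ1 : ∀ j, γ j ≤ 1) (c : ErrorCriterion) (s : ℕ) {ε : ℝ} (hε : 0 < ε) (hε1 : ε < 1) :
    ∃ n : ℕ, infoComplexity c α γ s ε = n ∧ 1 ≤ n ∧
      (1 - ε ^ 2) * Real.exp (lowerRate α * ∑ j ∈ Finset.range s, γ j) ≤ n ∧
      n ≤ 2 * (ε⁻¹ ^ 2 * Real.exp (upperRate α * ∑ j ∈ Finset.range s, γ j)) := by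
  set Y := ε⁻¹ ^ 2 * Real.exp (upperRate α * ∑ j ∈ Finset.range s, γ j) with hY
  have hS : 0 ≤ ∑ j ∈ Finset.range s, γ j := Finset.sum_nonneg fun j _ => (hγ j).le
  have hY1 : 1 ≤ Y := by
    have h1 : 1 ≤ ε⁻¹ := (one_le_inv₀ hε).2 hε1.le
    exact one_le_mul_of_one_le_of_one_le (one_le_pow₀ h1)
      (Real.one_le_exp (mul_nonneg (upperRate_nonneg α) hS))
  set A := {n : ℕ | minError α γ s n ≤ ENNReal.ofReal ε * c.scale α γ s}
  -- `Y` is chosen so that `exp (upperRate α * S) / n ≤ ε²` as soon as `n ≥ Y`. Since `Y ≥ 1`,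
  -- rounding up costs at most a factor `2`.
  have hm : ⌈Y⌉₊ ∈ A := by
    have hpos : 0 < ⌈Y⌉₊ := Nat.ceil_pos.2 (by linarith)
    have hpos' : (0 : ℝ) < ⌈Y⌉₊ := by exact_mod_cast hpos
    refine (minError_le_exp hα hγ s hpos).trans ?_
    refine le_trans (ENNReal.ofReal_le_ofReal (q := ε) ?_)
      (le_mul_of_one_le_right (zero_le) (one_le_scale hα hγ hγ1 c s))
    rw [Real.sqrt_le_left hε.le, div_le_iff₀ hpos']
    calc Real.exp (upperRate α * ∑ j ∈ Finset.range s, γ j) = ε ^ 2 * Y := by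
          rw [hY]; field_simp
      _ ≤ _ := by gcongr; exact Nat.le_ceil Y
  have heq : infoComplexity c α γ s ε = (sInf A : ℕ) := by
    refine le_antisymm (iInf₂_le (sInf A) (Nat.sInf_mem ⟨_, hm⟩)) (le_iInf₂ fun n hn => ?_)
    exact_mod_cast Nat.sInf_le hn
  have hlow := le_infoComplexity hα hγ hγ1 c s hε (Nat.sInf_mem ⟨_, hm⟩)
  refine ⟨sInf A, heq, ?_, hlow, ?_⟩
  · have h0 : 0 < (1 - ε ^ 2) * Real.exp (lowerRate α * ∑ j ∈ Finset.range s, γ j) :=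
      mul_pos (by nlinarith) (Real.exp_pos _)
    have h2 := h0.trans_le hlow
    exact_mod_cast h2
  · have h1 : (sInf A : ℕ) ≤ ⌈Y⌉₊ := Nat.sInf_le hm
    have h2 : ((sInf A : ℕ) : ℝ) ≤ ⌈Y⌉₊ := by exact_mod_cast h1
    have h3 := Nat.ceil_lt_add_one (by linarith : 0 ≤ Y)
    linarith

end

/-! ### From the two-sided bounds to the tractability notions -/

section

variable {α : ℕ} {γ : ℕ → ℝ} {c : ErrorCriterion}

theorem natCast_le_ofReal {n : ℕ} {N : ℕ∞} (hN : N = n) {r : ℝ} (hr : 0 ≤ r) :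
    (N : ℝ≥0∞) ≤ ENNReal.ofReal r ↔ (n : ℝ) ≤ r := by
  rw [hN, ENat.toENNReal_coe, ← ENNReal.ofReal_natCast, ENNReal.ofReal_le_ofReal_iff hr]

theorem monotone_sum_range (hγ : ∀ j, 0 < γ j) : Monotone fun s => ∑ j ∈ Finset.range s, γ j :=
  fun _ _ h => Finset.sum_le_sum_of_subset_of_nonneg (Finset.range_mono h) fun j _ _ => (hγ j).le

theorem spt_iff (hα : 1 < α) (hγ : ∀ j, 0 < γ j) (hγ1 : ∀ j, γ j ≤ 1) :
    SPT c α γ ↔ Summable γ := by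
  constructor
  · rintro ⟨τ, C, hτ, hC, h⟩
    have hK : 0 ≤ C * (1 / 2 : ℝ) ^ (-τ) := by positivity
    have hc := lowerRate_pos hα
    -- Fixing `ε = 1/2`, the factor `1 - ε² = 3/4` accounts for `4/3`; then `c S ≤ exp (c S)` bounds
    -- the partial sums.
    refine summable_of_sum_range_le (c := 4 / 3 * (C * (1 / 2 : ℝ) ^ (-τ)) / lowerRate α)
      (fun j => (hγ j).le) fun s => ?_
    rcases Nat.eq_zero_or_pos s with rfl | hs
    · rw [Finset.sum_range_zero]; positivity
    obtain ⟨n, hn, -, hlow, -⟩ :=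
      exists_infoComplexity_eq hα hγ hγ1 c s (ε := 1 / 2) (by norm_num) (by norm_num)
    have h1 := (natCast_le_ofReal hn hK).1 (h s hs (1 / 2) (by norm_num) (by norm_num))
    have h2 := Real.add_one_le_exp (lowerRate α * ∑ j ∈ Finset.range s, γ j)
    rw [le_div_iff₀ hc, mul_comm]
    linarith
  · intro h
    refine ⟨2, 2 * Real.exp (upperRate α * ∑' j, γ j), zero_le_two, by positivity,
      fun s _ ε hε hε1 => ?_⟩
    obtain ⟨n, hn, -, -, hup⟩ := exists_infoComplexity_eq hα hγ hγ1 c s hε hε1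
    refine (natCast_le_ofReal hn (by positivity)).2 (hup.trans ?_)
    have h1 : ∑ j ∈ Finset.range s, γ j ≤ ∑' j, γ j := h.sum_le_tsum _ fun j _ => (hγ j).le
    have h2 := upperRate_nonneg α
    rw [Real.rpow_neg hε.le, Real.rpow_two, inv_pow, mul_comm (ε ^ 2)⁻¹, ← mul_assoc]
    gcongr

theorem pt_iff (hα : 1 < α) (hγ : ∀ j, 0 < γ j) (hγ1 : ∀ j, γ j ≤ 1) :
    PT c α γ ↔ limsup (fun s : ℕ =>
      (((1 / Real.log s) * ∑ j ∈ Finset.range s, γ j : ℝ) : EReal)) atTop < ⊤ := by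
  constructor
  · rintro ⟨τ, σ, C, hτ, hσ, hC, h⟩
    set K := C * (1 / 2 : ℝ) ^ (-τ)
    have hK : 0 ≤ K := by positivity
    have hc := lowerRate_pos hα
    have hlog2 : 0 < Real.log 2 := Real.log_pos one_lt_two
    -- With `ε = 1/2`, taking logarithms gives `c S ≤ log (4K/3) + σ log s`. The constant is
    -- absorbed into a multiple of `log s` because `log s ≥ log 2` for `s ≥ 2`.
    refine lt_of_le_of_lt (limsup_le_of_le (a := (((|Real.log (4 / 3 * K)| / Real.log 2 + σ) /
      lowerRate α : ℝ) : EReal)) (by isBoundedDefault) ?_) (EReal.coe_lt_top _)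
    filter_upwards [eventually_ge_atTop 2] with s hs
    rw [EReal.coe_le_coe_iff]
    have hs' : (2 : ℝ) ≤ s := by exact_mod_cast hs
    have hs0 : (0 : ℝ) < s := by linarith
    obtain ⟨n, hn, -, hlow, -⟩ :=
      exists_infoComplexity_eq hα hγ hγ1 c s (ε := 1 / 2) (by norm_num) (by norm_num)
    have h1 := (natCast_le_ofReal hn (by positivity)).1
      (h s (by omega) (1 / 2) (by norm_num) (by norm_num))
    have h2 : Real.exp (lowerRate α * ∑ j ∈ Finset.range s, γ j) ≤ 4 / 3 * K * (s : ℝ) ^ σ := by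
      linarith
    have h3 : 0 < 4 / 3 * K * (s : ℝ) ^ σ := (Real.exp_pos _).trans_le h2
    have hsσ : 0 < (s : ℝ) ^ σ := Real.rpow_pos_of_pos hs0 σ
    have hK' : 4 / 3 * K ≠ 0 := fun h0 => by simp [h0] at h3
    have h4 := (Real.le_log_iff_exp_le h3).2 h2
    rw [Real.log_mul hK' hsσ.ne', Real.log_rpow hs0] at h4
    have hlogs : Real.log 2 ≤ Real.log s := Real.log_le_log two_pos hs'
    have hlogs0 : 0 < Real.log s := hlog2.trans_le hlogs
    have h5 : Real.log (4 / 3 * K) ≤ |Real.log (4 / 3 * K)| / Real.log 2 * Real.log s := by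
      refine (le_abs_self _).trans ?_
      exact (div_mul_cancel₀ _ hlog2.ne').symm.le.trans (by gcongr)
    rw [one_div, inv_mul_le_iff₀ hlogs0, mul_div_assoc', le_div_iff₀ hc]
    linarith
  · intro h
    obtain ⟨M, hM, -⟩ := EReal.lt_iff_exists_real_btwn.1 h
    obtain ⟨s₀, hs₀⟩ := eventually_atTop.1 (eventually_lt_of_limsup_lt hM)
    -- `B` covers the finitely many `s` below the threshold, including `s = 1`, where `log s = 0`.
    set B := ∑ j ∈ Finset.range (max s₀ 2), γ j with hB
    have hB0 : 0 ≤ B := Finset.sum_nonneg fun j _ => (hγ j).le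
    have hU := upperRate_nonneg α
    have hS : ∀ s : ℕ, 1 ≤ s → ∑ j ∈ Finset.range s, γ j ≤ B + |M| * Real.log s := by
      intro s hs
      have hlog : 0 ≤ Real.log s := Real.log_natCast_nonneg s
      rcases le_total s (max s₀ 2) with h1 | h1
      · have := monotone_sum_range hγ h1
        have h2 : 0 ≤ |M| * Real.log s := by positivity
        simp only at this
        linarith
      · have h2 : (2 : ℝ) ≤ s := by exact_mod_cast (le_max_right _ _).trans h1
        have h3 : 0 < Real.log s := Real.log_pos (by linarith)
        have h4 := EReal.coe_lt_coe_iff.1 (hs₀ s ((le_max_left _ _).trans h1))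
        rw [one_div, inv_mul_lt_iff₀ h3] at h4
        have h5 := mul_le_mul_of_nonneg_right (le_abs_self M) h3.le
        linarith
    refine ⟨2, upperRate α * |M|, 2 * Real.exp (upperRate α * B), zero_le_two, by positivity,
      by positivity, fun s hs ε hε hε1 => ?_⟩
    obtain ⟨n, hn, -, -, hup⟩ := exists_infoComplexity_eq hα hγ hγ1 c s hε hε1
    have hs0 : (0 : ℝ) < s := by exact_mod_cast hs
    refine (natCast_le_ofReal hn (by positivity)).2 (hup.trans ?_)
    have h1 : Real.exp (upperRate α * ∑ j ∈ Finset.range s, γ j) ≤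
        Real.exp (upperRate α * B) * (s : ℝ) ^ (upperRate α * |M|) := by
      rw [Real.rpow_def_of_pos hs0, ← Real.exp_add]
      refine Real.exp_le_exp.2 ((mul_le_mul_of_nonneg_left (hS s hs) hU).trans (le_of_eq ?_))
      ring
    rw [Real.rpow_neg hε.le, Real.rpow_two, inv_pow]
    calc _ ≤ 2 * ((ε ^ 2)⁻¹ * (Real.exp (upperRate α * B) * (s : ℝ) ^ (upperRate α * |M|))) := by
          gcongr
      _ = _ := by ring

theorem eventually_sizeAtTop : ∀ᶠ q in sizeAtTop, 1 ≤ q.1 ∧ 0 < q.2 ∧ q.2 < 1 :=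
  eventually_inf_principal.2 (Eventually.of_forall fun _ h => h)

/-- One of `s` and `ε⁻¹` is at least half their sum, so the corresponding power alone tends to
infinity with that sum. -/
theorem tendsto_size {σ τ : ℝ} (hσ : 0 < σ) (hτ : 0 < τ) :
    Tendsto (fun q : ℕ × ℝ => (q.1 : ℝ) ^ σ + q.2 ^ (-τ)) sizeAtTop atTop := by
  have h1 : Tendsto (fun q : ℕ × ℝ => (q.1 : ℝ) + q.2⁻¹) sizeAtTop atTop :=
    tendsto_comap.mono_left inf_le_left
  refine tendsto_atTop.2 fun R => ?_
  have h2 : Tendsto (fun x : ℝ => x / 2) atTop atTop := tendsto_id.atTop_div_const two_pos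
  have h3 := h1.eventually (((tendsto_rpow_atTop hσ).comp h2).eventually_ge_atTop R)
  have h4 := h1.eventually (((tendsto_rpow_atTop hτ).comp h2).eventually_ge_atTop R)
  filter_upwards [h3, h4, eventually_sizeAtTop] with q h3 h4 ⟨h5, h6, h7⟩
  simp only [Function.comp_apply] at h3 h4
  have h8 : (0 : ℝ) ≤ q.1 := Nat.cast_nonneg _
  have h9 : 0 < q.2⁻¹ := inv_pos.2 h6
  have h10 : 0 ≤ (q.1 : ℝ) ^ σ := by positivity
  rw [Real.rpow_neg h6.le, ← Real.inv_rpow h6.le]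
  have h11 : 0 ≤ q.2⁻¹ ^ τ := by positivity
  rcases le_total (q.1 : ℝ) q.2⁻¹ with h | h
  · have : (((q.1 : ℝ) + q.2⁻¹) / 2) ^ τ ≤ q.2⁻¹ ^ τ := by
      gcongr; linarith
    linarith
  · have : (((q.1 : ℝ) + q.2⁻¹) / 2) ^ σ ≤ (q.1 : ℝ) ^ σ := by
      gcongr; linarith
    linarith

theorem exists_log_infoComplexity_eq (hα : 1 < α) (hγ : ∀ j, 0 < γ j)
    (hγ1 : ∀ j, γ j ≤ 1) (c : ErrorCriterion) (s : ℕ) {ε : ℝ} (hε : 0 < ε) (hε1 : ε < 1) :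
    ENNReal.log (infoComplexity c α γ s ε : ℝ≥0∞) =
      (Real.log (infoComplexity c α γ s ε).toNat : EReal) ∧
    0 ≤ Real.log (infoComplexity c α γ s ε).toNat ∧
    Real.log (1 - ε ^ 2) + lowerRate α * ∑ j ∈ Finset.range s, γ j ≤
      Real.log (infoComplexity c α γ s ε).toNat ∧
    Real.log (infoComplexity c α γ s ε).toNat ≤
      Real.log 2 + 2 * Real.log ε⁻¹ + upperRate α * ∑ j ∈ Finset.range s, γ j := by
  obtain ⟨n, hn, hn1, hlow, hup⟩ := exists_infoComplexity_eq hα hγ hγ1 c s hε hε1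
  rw [hn, ENat.toNat_natCast, ENat.toENNReal_coe]
  have hn0 : (0 : ℝ) < n := by exact_mod_cast hn1
  have hε2 : 0 < 1 - ε ^ 2 := by nlinarith
  refine ⟨?_, Real.log_natCast_nonneg n, ?_, ?_⟩
  · rw [← ENNReal.ofReal_natCast, ENNReal.log_ofReal_of_pos hn0]
  · rw [← Real.log_exp (lowerRate α * _), ← Real.log_mul hε2.ne' (Real.exp_pos _).ne']
    exact Real.log_le_log (mul_pos hε2 (Real.exp_pos _)) hlow
  · refine (Real.log_le_log hn0 hup).trans (le_of_eq ?_)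
    rw [Real.log_mul two_ne_zero (by positivity), Real.log_mul (by positivity) (Real.exp_pos _).ne',
      Real.log_exp, Real.log_pow]
    push_cast; ring

theorem stwt_iff_real (hα : 1 < α) (hγ : ∀ j, 0 < γ j) (hγ1 : ∀ j, γ j ≤ 1) (σ τ : ℝ) :
    STWT c α γ σ τ ↔ Tendsto (fun q : ℕ × ℝ => Real.log (infoComplexity c α γ q.1 q.2).toNat /
      ((q.1 : ℝ) ^ σ + q.2 ^ (-τ))) sizeAtTop (𝓝 0) := by
  rw [STWT, ← EReal.coe_zero, ← EReal.tendsto_coe]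
  refine tendsto_congr' ?_
  filter_upwards [eventually_sizeAtTop] with q ⟨_, h2, h3⟩
  rw [(exists_log_infoComplexity_eq hα hγ hγ1 c q.1 h2 h3).1, EReal.coe_div]

/-- The limit is taken along `ε = 1/2`, where the lower bound on `log n` is linear in the sum of the
weights. -/
theorem tendsto_of_stwt (hα : 1 < α) (hγ : ∀ j, 0 < γ j) (hγ1 : ∀ j, γ j ≤ 1) {σ τ : ℝ}
    (hσ : 0 < σ) (h : STWT c α γ σ τ) :
    Tendsto (fun s : ℕ => (1 / (s : ℝ) ^ σ) * ∑ j ∈ Finset.range s, γ j) atTop (𝓝 0) := by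
  rw [stwt_iff_real hα hγ hγ1] at h
  have hc := lowerRate_pos hα
  have hpath : Tendsto (fun s : ℕ => (s, (1 / 2 : ℝ))) atTop sizeAtTop := by
    refine tendsto_inf.2 ⟨tendsto_comap_iff.2 ?_, tendsto_principal.2 ?_⟩
    · exact tendsto_atTop_add_const_right _ (1 / 2 : ℝ)⁻¹ (tendsto_natCast_atTop_atTop (R := ℝ))
    · filter_upwards [eventually_ge_atTop 1] with s hs
      exact ⟨hs, by norm_num, by norm_num⟩
  have h1 := h.comp hpath
  have hinv : Tendsto (fun s : ℕ => ((s : ℝ) ^ σ)⁻¹) atTop (𝓝 0) :=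
    ((tendsto_rpow_atTop hσ).comp tendsto_natCast_atTop_atTop).inv_tendsto_atTop
  set K : ℝ := (1 / 2 : ℝ) ^ (-τ) with hK
  -- Multiplying by `1 + K s ^ (-σ)`, which tends to `1`, replaces the denominator `s ^ σ + K` by `s
  -- ^ σ`; the second summand compensates for `log (1 - ε²)`.
  have h2 := ((h1.mul ((hinv.const_mul K).const_add 1)).add
    (hinv.const_mul (-Real.log (1 - (1 / 2) ^ 2)))).const_mul (lowerRate α)⁻¹
  simp only [mul_zero, add_zero, zero_mul] at h2
  refine squeeze_zero' (Eventually.of_forall fun s => ?_) ?_ h2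
  · exact mul_nonneg (by positivity) (Finset.sum_nonneg fun j _ => (hγ j).le)
  · filter_upwards [eventually_ge_atTop 1] with s hs
    obtain ⟨-, -, hlow, -⟩ := exists_log_infoComplexity_eq hα hγ hγ1 c s
      (ε := 1 / 2) (by norm_num) (by norm_num)
    have hs0 : (0 : ℝ) < s := by exact_mod_cast hs
    have hsσ : 0 < (s : ℝ) ^ σ := by positivity
    have hK0 : 0 < K := by positivity
    simp only [Function.comp_apply, ← hK]
    set L := Real.log (infoComplexity c α γ s (1 / 2)).toNat
    have h3 : L / ((s : ℝ) ^ σ + K) * (1 + K * ((s : ℝ) ^ σ)⁻¹) = L * ((s : ℝ) ^ σ)⁻¹ := by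
      field_simp
    rw [h3, ← add_mul, one_div, mul_comm, ← mul_assoc]
    gcongr
    rw [inv_mul_eq_div, le_div_iff₀ hc, mul_comm]
    linarith

theorem stwt_of_tendsto (hα : 1 < α) (hγ : ∀ j, 0 < γ j) (hγ1 : ∀ j, γ j ≤ 1) {σ τ : ℝ}
    (hσ : 0 < σ) (hτ : 0 < τ)
    (h : Tendsto (fun s : ℕ => (1 / (s : ℝ) ^ σ) * ∑ j ∈ Finset.range s, γ j) atTop (𝓝 0)) :
    STWT c α γ σ τ := by
  rw [stwt_iff_real hα hγ hγ1, Metric.tendsto_nhds]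
  intro δ hδ
  have hU := upperRate_nonneg α
  -- With this `η`, the terms of `log n` growing with `s` and `ε⁻¹` add up to at most `δ/4` times
  -- the size `s ^ σ + ε ^ (-τ)`. The constant `R` stays below `δ/2` times the size once the size
  -- exceeds `2R/δ`.
  set η := δ / (4 * (1 + upperRate α)) with hη
  have hη0 : 0 < η := by positivity
  obtain ⟨s₀, hs₀⟩ := eventually_atTop.1
    ((h.eventually (gt_mem_nhds hη0)).and (eventually_ge_atTop 1))
  set B := ∑ j ∈ Finset.range s₀, γ j with hB
  have hS : ∀ s : ℕ, ∑ j ∈ Finset.range s, γ j ≤ B + η * (s : ℝ) ^ σ := by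
    intro s
    rcases le_total s s₀ with h1 | h1
    · have h2 := monotone_sum_range hγ h1
      have h3 : 0 ≤ η * (s : ℝ) ^ σ := by positivity
      simp only at h2
      linarith
    · have h2 := hs₀ s h1
      have hs0 : (0 : ℝ) < s := by exact_mod_cast h2.2
      have h3 := h2.1
      rw [one_div, inv_mul_lt_iff₀ (by positivity)] at h3
      have h4 : 0 ≤ B := Finset.sum_nonneg fun j _ => (hγ j).le
      linarith
  -- From `log y ≤ y ^ (τ/2) / (τ/2)`, completing the square in `y ^ (τ/2)` leaves exactly this
  -- constant.
  set κ := 1 / (η * (τ / 2) ^ 2) with hκ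
  have hlog : ∀ ε : ℝ, 0 < ε → 2 * Real.log ε⁻¹ ≤ κ + η * ε ^ (-τ) := by
    intro ε hε
    have h1 := Real.log_le_rpow_div (inv_pos.2 hε).le (half_pos hτ)
    have h2 : ε ^ (-τ) = (ε⁻¹ ^ (τ / 2)) ^ 2 := by
      rw [← Real.rpow_natCast, ← Real.rpow_mul (inv_pos.2 hε).le, Real.rpow_neg hε.le,
        ← Real.inv_rpow hε.le]
      congr 1
      push_cast; ring
    rw [h2]
    set y := ε⁻¹ ^ (τ / 2)
    have h3 : κ + η * y ^ 2 - 2 * (y / (τ / 2)) = (η * y - 1 / (τ / 2)) ^ 2 / η := by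
      rw [hκ]; field_simp; ring
    have h4 : 0 ≤ (η * y - 1 / (τ / 2)) ^ 2 / η := by positivity
    linarith
  set R := Real.log 2 + κ + upperRate α * B with hR
  filter_upwards [eventually_sizeAtTop,
    (tendsto_size hσ hτ).eventually_gt_atTop (max 0 (2 * R / δ))] with q ⟨_, h2, h3⟩ h4
  obtain ⟨-, hnonneg, -, hup⟩ := exists_log_infoComplexity_eq hα hγ hγ1 c q.1 h2 h3
  obtain ⟨h5, h6⟩ := max_lt_iff.1 h4
  have hq1 : 0 ≤ (q.1 : ℝ) ^ σ := by positivity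
  have hq2 : 0 ≤ q.2 ^ (-τ) := by positivity
  rw [dist_zero_right, Real.norm_of_nonneg (div_nonneg hnonneg h5.le), div_lt_iff₀ h5]
  rw [div_lt_iff₀ hδ] at h6
  have h7 := mul_le_mul_of_nonneg_left (hS q.1) hU
  have h8 := hlog q.2 h2
  have h9 : η * (1 + upperRate α) = δ / 4 := by rw [hη]; field_simp
  have h10 : upperRate α * (η * (q.1 : ℝ) ^ σ) + η * q.2 ^ (-τ) ≤
      η * (1 + upperRate α) * ((q.1 : ℝ) ^ σ + q.2 ^ (-τ)) := by
    have h11 : 0 ≤ η * (q.1 : ℝ) ^ σ := by positivity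
    have h12 : 0 ≤ upperRate α * (η * q.2 ^ (-τ)) := by positivity
    nlinarith
  rw [h9] at h10
  have h13 : 0 < δ * ((q.1 : ℝ) ^ σ + q.2 ^ (-τ)) := by positivity
  nlinarith

theorem wt_iff_stwt : WT c α γ ↔ STWT c α γ 1 1 := by
  simp only [WT, STWT, Real.rpow_one, Real.rpow_neg_one]

end

end AnchoredSpace

end

theorem mainTheorem11 (α : ℕ) (hα : 1 < α) (γ : ℕ → ℝ) (hγ_pos : ∀ j, 0 < γ j)
    (hγ_le : ∀ j, γ j ≤ 1) (hγ_anti : Antitone γ) (c : AnchoredSpace.ErrorCriterion) :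
    (AnchoredSpace.SPT c α γ ↔ Summable γ) ∧
    (AnchoredSpace.PT c α γ ↔
      limsup (fun s : ℕ => (((1 / Real.log s) * ∑ j ∈ Finset.range s, γ j : ℝ) : EReal)) atTop
        < ⊤) ∧
    (AnchoredSpace.WT c α γ ↔
      Tendsto (fun s : ℕ => (1 / (s : ℝ)) * ∑ j ∈ Finset.range s, γ j) atTop (𝓝 0)) ∧
    (∀ σ τ : ℝ, 0 < σ → σ ≤ 1 → 0 < τ →
      (AnchoredSpace.STWT c α γ σ τ ↔
        Tendsto (fun s : ℕ => (1 / (s : ℝ) ^ σ) * ∑ j ∈ Finset.range s, γ j) atTop (𝓝 0))) ∧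
    (AnchoredSpace.UWT c α γ ↔
      ∀ σ : ℝ, 0 < σ → σ ≤ 1 →
        Tendsto (fun s : ℕ => (1 / (s : ℝ) ^ σ) * ∑ j ∈ Finset.range s, γ j) atTop (𝓝 0)) := by
  have h4 : ∀ σ τ : ℝ, 0 < σ → 0 < τ → (AnchoredSpace.STWT c α γ σ τ ↔
      Tendsto (fun s : ℕ => (1 / (s : ℝ) ^ σ) * ∑ j ∈ Finset.range s, γ j) atTop (𝓝 0)) :=
    fun σ τ hσ hτ => ⟨AnchoredSpace.tendsto_of_stwt hα hγ_pos hγ_le hσ,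
      AnchoredSpace.stwt_of_tendsto hα hγ_pos hγ_le hσ hτ⟩
  refine ⟨AnchoredSpace.spt_iff hα hγ_pos hγ_le, AnchoredSpace.pt_iff hα hγ_pos hγ_le, ?_,
    fun σ τ hσ _ hτ => h4 σ τ hσ hτ, fun h σ hσ hσ1 => ?_, fun h σ τ hσ hσ1 hτ _ => ?_⟩
  · rw [AnchoredSpace.wt_iff_stwt, h4 1 1 one_pos one_pos]
    simp only [Real.rpow_one]
  -- The condition on the weights does not involve `τ`, so the single value `τ = 1` suffices.
  · exact (h4 σ 1 hσ one_pos).1 (h σ 1 hσ hσ1 one_pos le_rfl)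
  · exact (h4 σ τ hσ hτ).2 (h σ hσ hσ1)
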